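/- Let $V$ be a finite non-empty set with $p$ elements, $n\ge 0$, $\delta>0$, $D$ a symmetric positive definite real $V\times V$ matrix and $x$ a real $n\times p$ matrix with columns indexed by $V$. Put $\delta^\star=\delta+n$ and $D^\star=D+x^\top x$. For a tree $T$ with vertex set $V$ and edge set $E$, let $M_T$ be the set of positive definite symmetric $\Delta$ such that, for $i\ne j$, $\Delta_{ij}\neq0$ if and only if $\{i,j\}\in E$, and let $d\Delta$ be Lebesgue measure in the free entries $\Delta_{ii}$ ($i\in V$) and $\Delta_{ij}$ ($\{i,j\}\in E$). The hyper-Wishart density with respect to $T$ with $\delta$ degrees of freedom and rate matrix $D$ is $$\widetilde p(\Delta\mid T)=\frac{h_T(\Delta)}{\int_{M_T} h_T\,d\Delta},\qquad h_T(\Delta)=|\Delta|^{(\delta-2)/2}e^{-\mathrm{tr}(D\Delta)/2},\qquad \Delta\in M_T .$$ Let $\widetilde p(x\mid\Delta)=\prod_{r=1}^n \mathcal N(x_r\mid 0,\Delta^{-1})$, where $x_r$ is the $r$-th row of $x$, and define the tree activation function as the uniform mixture over all trees $T$ on $V$, $$\widetilde p(x)=\sum_T \frac{1}{\#\{\text{trees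 on }V\}}\int_{M_T}\widetilde p(x\mid\Delta)\,\widetilde p(\Delta\mid T)\,d\Delta .$$ For $i\ne j$ put $$g_{ij}(\delta,D)=\frac{\Gamma\{(\delta+1)/2\}\,(D_{ii}D_{jj})^{\delta/2}}{\Gamma(\delta/2)\,|D_{\{i,j\}}|^{(\delta+1)/2}},\qquad w_{ij}=\frac{g_{ij}(\delta^\star,D^\star)}{g_{ij}(\delta,D)},$$ where $D_{\{i,j\}}$ is the $2\times2$ submatrix of $D$ with rows and columns $i,j$. Then, for every tree $T$ on $V$, $h_T$ is integrable, $\widetilde p(\cdot\mid T)$ is a probability density and the integral defining the mixture converges, and: (i) $$\widetilde p(x)=\frac{p^{2-p}\,\Gamma(\delta^\star/2)^{p}\,(\prod_{i\in V}D_{ii})^{\delta/2}}{\pi^{np/2}\,\Gamma(\delta/2)^{p}\,(\prod_{i\in V}D^\star_{ii})^{\delta^\star/2}}\;\sum_{E}\prod_{\{i,j\}\in E}w_{ij},$$ where the sum is over all edge sets $E$ such that $(V,E)$ is a tree. (ii) All the weights $w_{ij}$ ($i\neq j$) are positive and, as a function of arbitrary positive edge weights (with the factor in front of the sum fixed), the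 right-hand side of (i) is strictly increasing in each weight. Consequently, if $y$ is another real $n\times p$ matrix whose columns have the same Euclidean norms as those of $x$, if $w_{ij}(x)\le w_{ij}(y)$ for all $i\ne j$ and if the inequality is strict for at least one pair, then $\widetilde p(x)<\widetilde p(y)$. (iii) For all symmetric real edge weights $w_{ij}$ on pairs of distinct elements of $V$ (in particular for those above) and every $u\in V$, $\sum_{E}\prod_{\{i,j\}\in E}w_{ij}=|\Lambda^{\{u\}}|$, where $\Lambda$ is the weighted Laplacian, $\Lambda_{ij}=-w_{ij}$ for $i\ne j$ and $\Lambda_{ii}=\sum_{j\neq i}w_{ij}$, and $\Lambda^{\{u\}}$ is obtained from it by removing row and column $u$ (with determinant $1$ if $p=1$). -/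

import Mathlib

open MeasureTheory
open scoped Matrix

namespace TreeActivation

section Density

variable {V : Type*} [Fintype V] [DecidableEq V]

/-- Density at `y` of the multivariate Gaussian law with mean `m` and covariance matrix `S`. -/
noncomputable def gaussianDensity (m : V → ℝ) (S : Matrix V V ℝ) (y : V → ℝ) : ℝ :=
  ((2 * Real.pi) • S).det ^ (-(1 / 2) : ℝ) *
    Real.exp (-(1 / 2) * ((y - m) ⬝ᵥ (S⁻¹ *ᵥ (y - m))))

/-- `p̃(x ∣ Δ)`: the rows of `x` are independent centred Gaussian vectors with precision `Δ`. -/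
noncomputable def likelihood {n : ℕ} (x : Matrix (Fin n) V ℝ) (Δ : Matrix V V ℝ) : ℝ :=
  ∏ r, gaussianDensity 0 Δ⁻¹ (x r)

open Classical in
/-- The symmetric matrix whose diagonal is `θ.1`, whose entry at an edge of `T` is the
corresponding coordinate of `θ.2`, and whose other entries are zero. -/
noncomputable def precision (T : SimpleGraph V) (θ : (V → ℝ) × (T.edgeSet → ℝ)) :
    Matrix V V ℝ :=
  Matrix.of fun i j =>
    if i = j then θ.1 i
    else if h : T.Adj i j then θ.2 ⟨s(i, j), h⟩ else 0

/-- The positive definite matrices whose off-diagonal entry `(i, j)` is nonzero if and only if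
`{i, j}` is an edge of `T`, in the coordinates given by the free entries. -/
def precisionCone (T : SimpleGraph V) : Set ((V → ℝ) × (T.edgeSet → ℝ)) :=
  {θ | (precision T θ).PosDef ∧ ∀ i j, i ≠ j → (T.Adj i j ↔ precision T θ i j ≠ 0)}

open Classical in
/-- The reference measure `dΔ`: Lebesgue measure in the free entries (the diagonal entries, and
one entry for every edge of `T`). -/
noncomputable def entryMeasure (T : SimpleGraph V) : Measure ((V → ℝ) × (T.edgeSet → ℝ)) :=
  (volume : Measure (V → ℝ)).prod (volume : Measure (T.edgeSet → ℝ))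

/-- The unnormalized density `|Δ|^{(δ - 2)/2} exp(-tr(D Δ)/2)` on the cone of precision matrices
of `T`. -/
noncomputable def hyperWishartKernel (T : SimpleGraph V) (δ : ℝ) (D : Matrix V V ℝ) :
    (V → ℝ) × (T.edgeSet → ℝ) → ℝ :=
  (precisionCone T).indicator fun θ =>
    (precision T θ).det ^ ((δ - 2) / 2) *
      Real.exp (-(1 / 2) * (D * precision T θ).trace)

/-- `p̃(Δ ∣ T)`: the density with respect to `entryMeasure T` of the hyper-Wishart law on precision
matrices with degrees of freedom `δ` and rate matrix `D` (for a tree, which is decomposable, this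
is the `G`-Wishart law, i.e. the law of the inverse of a hyper inverse Wishart matrix). The
normalizing constant is the integral of the kernel. -/
noncomputable def hyperWishartDensity (T : SimpleGraph V) (δ : ℝ) (D : Matrix V V ℝ)
    (θ : (V → ℝ) × (T.edgeSet → ℝ)) : ℝ :=
  hyperWishartKernel T δ D θ / ∫ η, hyperWishartKernel T δ D η ∂(entryMeasure T)

/-- `p̃(x ∣ T) = ∫ p̃(x ∣ Δ) p̃(Δ ∣ T) dΔ`. -/
noncomputable def marginalLikelihood {n : ℕ} (T : SimpleGraph V) (δ : ℝ) (D : Matrix V V ℝ)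
    (x : Matrix (Fin n) V ℝ) : ℝ :=
  ∫ θ, likelihood x (precision T θ) * hyperWishartDensity T δ D θ ∂(entryMeasure T)

variable (V) in
open Classical in
/-- All trees with vertex set `V`. -/
noncomputable def trees : Finset (SimpleGraph V) :=
  Finset.univ.filter fun T => T.IsTree

/-- The tree activation function `p̃(x) = ∑_T p̃(T) p̃(x ∣ T)`, with `p̃(T)` uniform over all
trees on `V`. -/
noncomputable def treeActivation {n : ℕ} (δ : ℝ) (D : Matrix V V ℝ)
    (x : Matrix (Fin n) V ℝ) : ℝ :=
  ∑ T ∈ trees V, ((trees V).card : ℝ)⁻¹ * marginalLikelihood T δ D x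

end Density

section Weights

variable {V : Type*}

/-- `g_ij(δ, D)`. -/
noncomputable def g (δ : ℝ) (D : Matrix V V ℝ) (i j : V) : ℝ :=
  (Real.Gamma ((δ + 1) / 2) * (D i i * D j j) ^ (δ / 2)) /
    (Real.Gamma (δ / 2) * (D.submatrix ![i, j] ![i, j]).det ^ ((δ + 1) / 2))

theorem g_comm (δ : ℝ) (D : Matrix V V ℝ) (i j : V) : g δ D i j = g δ D j i := by
  have h : (D.submatrix ![i, j] ![i, j]).det = (D.submatrix ![j, i] ![j, i]).det := by
    simp only [Matrix.det_fin_two, Matrix.submatrix_apply, Matrix.cons_val_zero,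
      Matrix.cons_val_one]
    ring
  rw [g, g, h, mul_comm (D i i)]

/-- `D⋆ = D + xᵀ x`. -/
def rateStar {n : ℕ} (D : Matrix V V ℝ) (x : Matrix (Fin n) V ℝ) : Matrix V V ℝ :=
  D + xᵀ * x

/-- The edge weight `w_ij = g_ij(δ⋆, D⋆) / g_ij(δ, D)` as a function of the unordered pair
`{i, j}`, where `δ⋆ = δ + n`. -/
noncomputable def edgeWeight {n : ℕ} (δ : ℝ) (D : Matrix V V ℝ) (x : Matrix (Fin n) V ℝ) :
    Sym2 V → ℝ :=
  Sym2.lift ⟨fun i j => g (δ + n) (rateStar D x) i j / g δ D i j, fun i j => by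
    simp only [g_comm _ _ i j]⟩

variable [Fintype V] [DecidableEq V]

open Classical in
/-- `∑_E ∏_{(i,j) ∈ E} w_ij`, over all edge sets `E` such that `(V, E)` is a tree. -/
noncomputable def treeSum (w : Sym2 V → ℝ) : ℝ :=
  ∑ T ∈ trees V, ∏ e ∈ T.edgeFinset, w e

/-- The product of Gamma and diagonal factors, times the sum over trees, as a function of the
edge weights `w`. -/
noncomputable def weightFormula {n : ℕ} (δ : ℝ) (D : Matrix V V ℝ) (x : Matrix (Fin n) V ℝ)
    (w : Sym2 V → ℝ) : ℝ :=
  ((Fintype.card V : ℝ) ^ (2 - (Fintype.card V : ℤ)) *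
      Real.Gamma ((δ + n) / 2) ^ Fintype.card V * (∏ i, D i i) ^ (δ / 2)) /
    (Real.pi ^ ((n : ℝ) * Fintype.card V / 2) *
      Real.Gamma (δ / 2) ^ Fintype.card V * (∏ i, rateStar D x i i) ^ ((δ + n) / 2)) *
    treeSum w

/-- The Laplacian matrix of the weighted graph with edge weights `w`. -/
def laplacian (w : Sym2 V → ℝ) : Matrix V V ℝ :=
  Matrix.of fun i j =>
    if i = j then ∑ k ∈ Finset.univ.erase i, w s(i, k) else -w s(i, j)

/-- `M^ν`: the rows and columns indexed by `ν` are removed. -/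
def removeNodes (M : Matrix V V ℝ) (ν : Finset V) : Matrix {v // v ∉ ν} {v // v ∉ ν} ℝ :=
  M.submatrix Subtype.val Subtype.val

end Weights

end TreeActivation

set_option linter.unusedSectionVars false

namespace TreeActivation

/-! ### Spanning trees as parent functions, and the weighted matrix-tree theorem -/

section MatrixTree

variable {V : Type*} [Fintype V] [DecidableEq V]

/-! Root the tree and eliminate children before parents. No fill-in occurs, so `Δ = Lᵀ diag(a) L`
with `L` unitriangular, and `Δ` is positive definite exactly when all pivots `a v` are positive. For
fixed edge entries `t`, the map from pivots to diagonal entries has Jacobian determinant 1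
(`setLIntegral_posDef_forestMatrix`). In these coordinates the determinant is `∏ a v` and the trace
is a sum of vertex terms and edge terms, so the integral of the kernel factors: a Gaussian integral
for each edge entry, then a Gamma integral for each pivot (`lintegral_forest`). The result is a
product of vertex constants and of factors `2 * √π * g` over the edges, from which the choice of
root has disappeared.

The Gaussian likelihood is conjugate: it turns the kernel for `(δ, D)` into a constant times the
kernel for `(δ + n, D⋆)`. The marginal likelihood of a tree is therefore a ratio of normalizing
constants, a factor common to all trees times `∏ w e`, and summing over trees gives (i). The number
of trees is the matrix-tree determinant with unit weights.

For the matrix-tree theorem, write row `i` of the reduced Laplacian as `∑ k, w_ik (e_i - e_k)` with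
`e_u = 0` and expand by multilinearity. The terms are indexed by parent functions; the determinant
is 1 for those that lead every vertex to the root, which correspond to trees, and 0 for the others.
Monotonicity holds because the tree sum is a polynomial with nonnegative coefficients in which every
edge occurs, since every edge lies in a star. -/

theorem _root_.Matrix.det_one_sub_eq_one_of_rank {I R : Type*} [Fintype I] [DecidableEq I]
    [CommRing R] (N : Matrix I I R) (h : I → ℕ) (hN : ∀ i j, N i j ≠ 0 → h i < h j) :
    (1 - N).det = 1 := by
  -- Several indices may share a rank, so the matrix is only block triangular; its diagonal blocks
  -- are identities because `N` vanishes within a level.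
  have hB : (1 - N).BlockTriangular h := by
    intro i j hij
    have h0 : N i j = 0 := by
      by_contra h0
      exact absurd (hN i j h0) (by omega)
    have hne : i ≠ j := by rintro rfl; exact lt_irrefl _ hij
    simp [h0, Matrix.one_apply_ne hne]
  rw [hB.det]
  refine Finset.prod_eq_one fun k _ => ?_
  have : (1 - N).toSquareBlock h k = 1 := by
    ext i j
    have h0 : N i j = 0 := by
      by_contra h0
      have := hN i j h0
      rw [i.2, j.2] at this
      exact lt_irrefl _ this
    simp [Matrix.toSquareBlock, Matrix.toSquareBlockProp, h0, Matrix.one_apply, Subtype.ext_iff]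
  rw [this, Matrix.det_one]

/-- A parent function on the vertices other than the root `u` is ranked if some rank function
decreases from every vertex to its parent. -/
def IsRanked {u : V} (f : {v // v ∉ ({u} : Finset V)} → V) : Prop :=
  ∃ h : V → ℕ, ∀ i, h (f i) < h i

/-- The graph joining every vertex other than the root to its parent. -/
def parentGraph {u : V} (f : {v // v ∉ ({u} : Finset V)} → V) : SimpleGraph V :=
  SimpleGraph.fromEdgeSet (Set.range fun i => s(i.1, f i))

variable {u : V} {f : {v // v ∉ ({u} : Finset V)} → V}

/-- Two vertices with the same parent edge would be each other's parent, and the rank would decrease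
both ways. -/
theorem IsRanked.injective (hf : IsRanked f) : Function.Injective fun i => s(i.1, f i) := by
  obtain ⟨h, hh⟩ := hf
  intro i j hij
  have hi := hh i
  have hj := hh j
  rcases Sym2.eq_iff.mp hij with ⟨h1, -⟩ | ⟨h1, h2⟩
  · exact Subtype.ext h1
  · rw [← h1] at hj
    rw [h2] at hi
    omega

theorem IsRanked.edgeSet_parentGraph (hf : IsRanked f) :
    (parentGraph f).edgeSet = Set.range fun i => s(i.1, f i) := by
  obtain ⟨h, hh⟩ := hf
  rw [parentGraph, SimpleGraph.edgeSet_fromEdgeSet, sdiff_eq_left, Set.disjoint_left]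
  rintro _ ⟨i, rfl⟩ hd
  have hd' : i.1 = f i := by simpa using hd
  have := hh i
  rw [← hd'] at this
  exact lt_irrefl _ this

theorem IsRanked.adj_parentGraph (hf : IsRanked f) (i) : (parentGraph f).Adj i.1 (f i) := by
  rw [← SimpleGraph.mem_edgeSet, hf.edgeSet_parentGraph]
  exact ⟨i, rfl⟩

/-- Descending in rank leads every vertex to `u`, so the graph is connected; by injectivity it has
exactly one edge fewer than vertices. -/
theorem IsRanked.isTree_parentGraph (hf : IsRanked f) : (parentGraph f).IsTree := by
  have hreach : ∀ v, (parentGraph f).Reachable v u := by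
    obtain ⟨h, hh⟩ := id hf
    intro v
    induction hn : h v using Nat.strong_induction_on generalizing v with
    | _ n ih =>
      by_cases hv : v = u
      · rw [hv]
      · let i : {v // v ∉ ({u} : Finset V)} := ⟨v, by simpa using hv⟩
        exact (hf.adj_parentGraph i).reachable.trans (ih _ (hn ▸ hh i) (f i) rfl)
  rw [SimpleGraph.isTree_iff_connected_and_card]
  have : Nonempty V := ⟨u⟩
  refine ⟨⟨fun v w => (hreach v).trans (hreach w).symm⟩, ?_⟩
  rw [hf.edgeSet_parentGraph, Nat.card_range_of_injective hf.injective]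
  have h1 : Nat.card {v // v ∉ ({u} : Finset V)} = Fintype.card V - 1 := by
    rw [Nat.card_eq_fintype_card]
    simp
  have h2 : 0 < Fintype.card V := Fintype.card_pos_iff.mpr ⟨u⟩
  rw [h1, Nat.card_eq_fintype_card]
  omega

/-- Induction on the rank. If the edge from `i` to `f i` were instead the `f'`-edge of a vertex `j`,
then `j = f i` and `f' j = i`. As `j` has smaller rank, `f j = f' j = i`, and the rank would
decrease around a 2-cycle. -/
theorem IsRanked.parentGraph_injOn {f' : {v // v ∉ ({u} : Finset V)} → V} (hf : IsRanked f)
    (hf' : IsRanked f') (hff : parentGraph f = parentGraph f') : f = f' := by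
  obtain ⟨h, hh⟩ := id hf
  suffices key : ∀ (n : ℕ) (i : {v // v ∉ ({u} : Finset V)}), h i = n → f i = f' i from
    funext fun i => key _ i rfl
  intro n
  induction n using Nat.strong_induction_on with
  | _ n ih =>
    intro i hi
    by_contra hne
    have hmem : s(i.1, f i) ∈ (parentGraph f').edgeSet := by
      rw [← hff, hf.edgeSet_parentGraph]
      exact ⟨i, rfl⟩
    rw [hf'.edgeSet_parentGraph] at hmem
    obtain ⟨j, hj⟩ := hmem
    rcases Sym2.eq_iff.mp hj with ⟨h1, h2⟩ | ⟨h1, h2⟩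
    · rw [Subtype.ext h1] at h2
      exact hne h2.symm
    · have hlt : h j < h i := h1 ▸ hh i
      have hj' := ih _ (hi ▸ hlt) j rfl
      have := hh j
      rw [hj', h2] at this
      omega

/-- The parent is the next vertex on a geodesic to `u`, ranked by distance. The parent graph is
contained in `T` and is a tree on the same vertices, so the edge counts force equality. -/
theorem exists_isRanked_parentGraph_eq {T : SimpleGraph V} (hT : T.IsTree) (u : V) :
    ∃ f : {v // v ∉ ({u} : Finset V)} → V, IsRanked f ∧ parentGraph f = T := by
  have hstep : ∀ i : {v // v ∉ ({u} : Finset V)}, ∃ w, T.Adj i w ∧ T.dist w u < T.dist i u := by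
    intro i
    obtain ⟨v, hv⟩ := i
    obtain ⟨p, hp⟩ := hT.connected.exists_walk_length_eq_dist v u
    cases p with
    | nil => exact absurd hv (by simp)
    | cons hadj q =>
      rw [SimpleGraph.Walk.length_cons] at hp
      refine ⟨_, hadj, ?_⟩
      have := SimpleGraph.dist_le q
      change _ < T.dist v u
      omega
  choose f hf hlt using hstep
  have hr : IsRanked f := ⟨fun v => T.dist v u, hlt⟩
  refine ⟨f, hr, ?_⟩
  have hle : parentGraph f ≤ T := by
    rw [← SimpleGraph.edgeSet_subset_edgeSet, hr.edgeSet_parentGraph]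
    rintro _ ⟨i, rfl⟩
    exact hf i
  have h1 := (SimpleGraph.isTree_iff_connected_and_card.mp hr.isTree_parentGraph).2
  have h2 := (SimpleGraph.isTree_iff_connected_and_card.mp hT).2
  have := Set.eq_of_subset_of_ncard_le (SimpleGraph.edgeSet_subset_edgeSet.mpr hle)
    (by rw [← Nat.card_coe_set_eq, ← Nat.card_coe_set_eq]; omega)
  exact SimpleGraph.edgeSet_injective this

open Classical in
theorem treeSum_eq_sum_isRanked (w : Sym2 V → ℝ) (u : V) :
    treeSum w = ∑ f : {v // v ∉ ({u} : Finset V)} → V,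
      if IsRanked f then ∏ i, w s(i.1, f i) else 0 := by
  rw [← Finset.sum_filter, treeSum]
  symm
  refine Finset.sum_bij (fun f _ => parentGraph f) ?_ ?_ ?_ ?_
  · intro f hf
    simpa [trees] using (Finset.mem_filter.mp hf).2.isTree_parentGraph
  · intro f hf f' hf'
    exact (Finset.mem_filter.mp hf).2.parentGraph_injOn (Finset.mem_filter.mp hf').2
  · intro T hT
    obtain ⟨f, hf, rfl⟩ := exists_isRanked_parentGraph_eq (Finset.mem_filter.mp hT).2 u
    exact ⟨f, by simpa using hf, rfl⟩
  · intro f hf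
    have hr := (Finset.mem_filter.mp hf).2
    have : (parentGraph f).edgeFinset = Finset.univ.image fun i => s(i.1, f i) := by
      ext e
      rw [SimpleGraph.mem_edgeFinset, hr.edgeSet_parentGraph]
      simp
    rw [this, Finset.prod_image fun i _ j _ hij => hr.injective hij]

/-- The reduced incidence matrix of a parent function: the row of `i` is the unit vector of `i`
minus that of its parent, where the unit vector of the root is zero. -/
def parentMatrix (f : {v // v ∉ ({u} : Finset V)} → V) :
    Matrix {v // v ∉ ({u} : Finset V)} {v // v ∉ ({u} : Finset V)} ℝ :=
  1 - Matrix.of fun i j => if f i = j.1 then 1 else 0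

theorem IsRanked.det_parentMatrix (hf : IsRanked f) : (parentMatrix f).det = 1 := by
  obtain ⟨h, hh⟩ := hf
  rw [← Matrix.det_transpose, parentMatrix, Matrix.transpose_sub, Matrix.transpose_one]
  refine Matrix.det_one_sub_eq_one_of_rank _ (fun i => h i.1) fun i j hij => ?_
  have : f j = i.1 := by
    by_contra hne
    simp [hne] at hij
  rw [← this]
  exact hh j

/-- If iterated parents always reached the root, the number of steps would be a rank. Otherwise the
indicator of the vertices that never reach it is a nonzero kernel vector, as a vertex reaches the
root if and only if its parent does. -/
theorem det_parentMatrix_of_not_isRanked (hf : ¬ IsRanked f) : (parentMatrix f).det = 0 := by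
  classical
  let F : V → V := fun v => if hv : v ∉ ({u} : Finset V) then f ⟨v, hv⟩ else u
  have hF : ∀ i : {v // v ∉ ({u} : Finset V)}, F i.1 = f i := fun i => dif_pos i.2
  let R : V → Prop := fun v => ∃ n, F^[n] v = u
  have hRF : ∀ i : {v // v ∉ ({u} : Finset V)}, R i.1 ↔ R (f i) := by
    intro i
    constructor
    · rintro ⟨n, hn⟩
      cases n with
      | zero => exact absurd i.2 (by simpa using hn)
      | succ n => exact ⟨n, by rw [← hF, ← Function.iterate_succ_apply, hn]⟩
    · rintro ⟨n, hn⟩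
      exact ⟨n + 1, by rw [Function.iterate_succ_apply, hF, hn]⟩
  obtain ⟨v, hv⟩ : ∃ v, ¬ R v := by
    by_contra! hR
    refine hf ⟨fun v => Nat.find (hR v), fun i => ?_⟩
    change Nat.find (hR (f i)) < Nat.find (hR i.1)
    have hspec := Nat.find_spec (hR i.1)
    cases hn : Nat.find (hR i.1) with
    | zero =>
      rw [hn] at hspec
      exact absurd i.2 (by simpa using hspec)
    | succ n =>
      rw [hn, Function.iterate_succ_apply, hF] at hspec
      exact Nat.lt_succ_of_le (Nat.find_min' (hR (f i)) hspec)
  have hvu : v ∉ ({u} : Finset V) := by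
    intro h
    exact hv ⟨0, by simpa using h⟩
  have hRu : R u := ⟨0, rfl⟩
  refine Matrix.exists_mulVec_eq_zero_iff.mp ⟨fun i => if R i.1 then 0 else 1, ?_, ?_⟩
  · intro h0
    simpa [hv] using congrFun h0 ⟨v, hvu⟩
  · ext i
    rw [parentMatrix, Matrix.sub_mulVec, Matrix.one_mulVec]
    have : ((Matrix.of fun i j => if f i = j.1 then 1 else 0 :
        Matrix {v // v ∉ ({u} : Finset V)} {v // v ∉ ({u} : Finset V)} ℝ) *ᵥ
          fun i => if R i.1 then 0 else 1) i = if R (f i) then 0 else 1 := by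
      simp only [Matrix.mulVec, dotProduct, Matrix.of_apply]
      by_cases hu : f i = u
      · rw [hu, if_pos hRu]
        refine Finset.sum_eq_zero fun j _ => ?_
        have : u ≠ j.1 := fun h => j.2 (by simp [h])
        simp [this]
      · rw [Finset.sum_eq_single ⟨f i, by simpa using hu⟩]
        · simp
        · intro j _ hj
          have : f i ≠ j.1 := fun h => hj (Subtype.ext h.symm)
          simp [this]
        · simp
    simp [this, hRF i]

/-- The weighted matrix-tree theorem. -/
theorem treeSum_eq_det (w : Sym2 V → ℝ) (u : V) :
    treeSum w = (removeNodes (laplacian w) {u}).det := by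
  classical
  -- The coefficient at `k = i` is set to 0, which discards the meaningless weight `w s(i, i)`;
  -- ranked parent functions never select it.
  have hrow : removeNodes (laplacian w) {u} = fun i => ∑ k : V,
      (if k = i.1 then 0 else w s(i.1, k)) •
        fun j : {v // v ∉ ({u} : Finset V)} =>
          ((1 : Matrix {v // v ∉ ({u} : Finset V)} {v // v ∉ ({u} : Finset V)} ℝ) i j -
            if k = j.1 then 1 else 0) := by
    ext i j
    rw [Finset.sum_apply]
    simp only [removeNodes, laplacian, Matrix.submatrix_apply, Matrix.of_apply, Pi.smul_apply,
      smul_eq_mul, mul_sub, Finset.sum_sub_distrib]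
    simp only [mul_ite, mul_one, mul_zero, Finset.sum_ite_eq', Finset.mem_univ, if_true]
    by_cases hij : i = j
    · subst hij
      simp only [if_true, Matrix.one_apply_eq, mul_one, sub_zero]
      rw [← Finset.sum_erase_add _ _ (Finset.mem_univ i.1)]
      simp only [if_true, add_zero]
      exact Finset.sum_congr rfl fun k hk => by rw [if_neg (Finset.ne_of_mem_erase hk)]
    · have h1 : i.1 ≠ j.1 := fun h => hij (Subtype.ext h)
      simp [Matrix.one_apply_ne hij, h1, h1.symm]
  have hdet : ∀ M : Matrix {v // v ∉ ({u} : Finset V)} {v // v ∉ ({u} : Finset V)} ℝ,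
      M.det = Matrix.detRowAlternating.toMultilinearMap M := fun _ => rfl
  rw [hdet, hrow, MultilinearMap.map_sum, treeSum_eq_sum_isRanked w u]
  refine Finset.sum_congr rfl fun f _ => ?_
  rw [MultilinearMap.map_smul_univ]
  change _ = _ • (parentMatrix f).det
  split_ifs with hf
  · rw [hf.det_parentMatrix, smul_eq_mul, mul_one]
    obtain ⟨h, hh⟩ := hf
    refine Finset.prod_congr rfl fun i _ => ?_
    rw [if_neg]
    intro hi
    have := hh i
    rw [hi] at this
    exact lt_irrefl _ this
  · rw [det_parentMatrix_of_not_isRanked hf, smul_zero]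

theorem treeSum_one : treeSum (fun _ : Sym2 V => (1 : ℝ)) = ((trees V).card : ℝ) := by
  simp [treeSum]

/-- Cayley's formula. -/
theorem card_trees [Nonempty V] :
    ((trees V).card : ℝ) = (Fintype.card V : ℝ) ^ ((Fintype.card V : ℤ) - 2) := by
  obtain ⟨u⟩ := ‹Nonempty V›
  have hp : (Fintype.card V : ℝ) ≠ 0 := by
    have : 0 < Fintype.card V := Fintype.card_pos_iff.mpr ⟨u⟩
    positivity
  have hcard : Fintype.card {v // v ∉ ({u} : Finset V)} = Fintype.card V - 1 := by simp
  have h1 : 1 ≤ Fintype.card V := Fintype.card_pos_iff.mpr ⟨u⟩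
  -- With unit weights the reduced Laplacian is `p (1 - J / p)` with `J` the all-ones matrix of size
  -- `p - 1`. The rank-one determinant identity gives `p ^ (p - 1) * (1 - (p - 1) / p)`.
  have hM : removeNodes (laplacian fun _ : Sym2 V => (1 : ℝ)) {u} =
      (Fintype.card V : ℝ) • (1 - Matrix.replicateCol Unit (fun _ => (Fintype.card V : ℝ)⁻¹) *
        Matrix.replicateRow Unit (fun _ => (1 : ℝ))) := by
    ext i j
    by_cases hij : i = j
    · subst hij
      simp [removeNodes, laplacian, Matrix.mul_apply, mul_sub, hp, Nat.cast_sub h1]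
    · have h1 : i.1 ≠ j.1 := fun h => hij (Subtype.ext h)
      simp [removeNodes, laplacian, Matrix.mul_apply, hp, hij, h1]
  rw [← treeSum_one, treeSum_eq_det _ u, hM, Matrix.det_smul, Matrix.det_one_sub_mul_comm,
    Matrix.det_unique, hcard]
  simp only [Matrix.sub_apply, Matrix.one_apply_eq, Matrix.mul_apply, Matrix.replicateRow_apply,
    Matrix.replicateCol_apply, one_mul, Finset.sum_const, Finset.card_univ, hcard, nsmul_eq_mul,
    Nat.cast_sub h1, Nat.cast_one]
  have h2 : 1 - ((Fintype.card V : ℝ) - 1) * (Fintype.card V : ℝ)⁻¹ = (Fintype.card V : ℝ)⁻¹ := by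
    field_simp
    ring
  rw [h2, ← zpow_natCast, ← zpow_sub_one₀ hp]
  congr 1
  omega

/-- The star centred at `i` is such a tree. -/
theorem exists_mem_trees_adj {i j : V} (hij : i ≠ j) : ∃ T ∈ trees V, T.Adj i j := by
  have hr : IsRanked (fun _ : {v // v ∉ ({i} : Finset V)} => i) :=
    ⟨fun v => if v = i then 0 else 1, fun k => by
      have : k.1 ≠ i := by simpa using k.2
      simp [this]⟩
  refine ⟨parentGraph fun _ : {v // v ∉ ({i} : Finset V)} => i, ?_, ?_⟩
  · simpa [trees] using hr.isTree_parentGraph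
  · exact (hr.adj_parentGraph ⟨j, by simpa using hij.symm⟩).symm

theorem treeSum_lt_treeSum {w w' : Sym2 V → ℝ} (hw : ∀ i j : V, i ≠ j → 0 < w s(i, j))
    (hle : ∀ i j : V, i ≠ j → w s(i, j) ≤ w' s(i, j))
    (hlt : ∃ i j : V, i ≠ j ∧ w s(i, j) < w' s(i, j)) : treeSum w < treeSum w' := by
  classical
  have hpos : ∀ (T : SimpleGraph V), ∀ e ∈ T.edgeFinset, 0 < w e ∧ w e ≤ w' e := by
    intro T e he
    induction e using Sym2.ind with
    | _ i j =>
      have : i ≠ j := (SimpleGraph.mem_edgeFinset.mp he : T.Adj i j).ne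
      exact ⟨hw i j this, hle i j this⟩
  obtain ⟨i, j, hij, hlt⟩ := hlt
  obtain ⟨T, hT, hadj⟩ := exists_mem_trees_adj hij
  refine Finset.sum_lt_sum (fun T _ => ?_) ⟨T, hT, ?_⟩
  · exact Finset.prod_le_prod (fun e he => (hpos T e he).1.le) fun e he => (hpos T e he).2
  · exact Finset.prod_lt_prod (fun e he => (hpos T e he).1) (fun e he => (hpos T e he).2)
      ⟨s(i, j), SimpleGraph.mem_edgeFinset.mpr hadj, hlt⟩

theorem strictMonoOn_treeSum_update {w : Sym2 V → ℝ} (hw : ∀ i j : V, i ≠ j → 0 < w s(i, j))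
    {i j : V} (hij : i ≠ j) :
    StrictMonoOn (fun t : ℝ => treeSum (Function.update w s(i, j) t)) (Set.Ioi 0) := by
  intro a ha b _ hab
  refine treeSum_lt_treeSum (fun k l hkl => ?_) (fun k l hkl => ?_) ⟨i, j, hij, by simpa using hab⟩
  · by_cases h : s(k, l) = s(i, j)
    · rw [h, Function.update_self]
      exact ha
    · rw [Function.update_of_ne h]
      exact hw k l hkl
  · by_cases h : s(k, l) = s(i, j)
    · rw [h, Function.update_self, Function.update_self]
      exact hab.le
    · rw [Function.update_of_ne h, Function.update_of_ne h]

end MatrixTree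

/-! ### One-variable Gaussian and Gamma integrals -/

section OneVariable

/-- Complete the square around `-a * b / A`. In the application `t` is an edge entry, `a` the pivot
of the child, `b` the entry of `D` at the edge and `A` its diagonal entry at the parent. -/
theorem integrable_exp_quadratic {A : ℝ} (hA : 0 < A) (b : ℝ) {a : ℝ} (ha : 0 < a) :
    Integrable (fun t : ℝ => Real.exp (-(1 / 2) * (2 * t * b + A * (t ^ 2 / a)))) ∧
      ∫ t : ℝ, Real.exp (-(1 / 2) * (2 * t * b + A * (t ^ 2 / a))) =
        √(2 * Real.pi / A) * a ^ (1 / 2 : ℝ) * Real.exp (a * (b ^ 2 / (2 * A))) := by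
  have hfun : (fun t : ℝ => Real.exp (-(1 / 2) * (2 * t * b + A * (t ^ 2 / a)))) = fun t =>
      Real.exp (a * (b ^ 2 / (2 * A))) * Real.exp (-(A / (2 * a)) * (t + a * b / A) ^ 2) := by
    ext t
    rw [← Real.exp_add]
    congr 1
    field_simp
    ring
  have hpos : 0 < A / (2 * a) := by positivity
  rw [hfun]
  refine ⟨((integrable_exp_neg_mul_sq hpos).comp_add_right (a * b / A)).const_mul _, ?_⟩
  rw [integral_const_mul,
    integral_add_right_eq_self (fun t : ℝ => Real.exp (-(A / (2 * a)) * t ^ 2)) (a * b / A),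
    integral_gaussian, ← Real.sqrt_eq_rpow, ← Real.sqrt_mul (by positivity), mul_comm]
  congr 2
  field_simp

theorem integrable_rpow_mul_exp {s r : ℝ} (hs : 0 < s) (hr : 0 < r) :
    Integrable (fun t : ℝ => t ^ (s - 1) * Real.exp (-(r * t))) (volume.restrict (Set.Ioi 0)) ∧
      ∫ t : ℝ in Set.Ioi 0, t ^ (s - 1) * Real.exp (-(r * t)) = (1 / r) ^ s * Real.Gamma s := by
  have h := Real.integral_rpow_mul_exp_neg_mul_Ioi hs hr
  refine ⟨?_, h⟩
  -- The integral of a non-integrable function is 0 by convention, so a positive value proves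
  -- integrability.
  refine Integrable.of_integral_ne_zero ?_
  rw [h]
  have := Real.Gamma_pos_of_pos hs
  positivity

theorem lintegral_ofReal_prod {κ : Type*} [Fintype κ] (μ : κ → Measure ℝ) [∀ k, SigmaFinite (μ k)]
    (f : κ → ℝ → ℝ) (hf : ∀ k, Integrable (f k) (μ k)) (h0 : ∀ k, 0 ≤ᵐ[μ k] f k) :
    ∫⁻ x, ∏ k, ENNReal.ofReal (f k (x k)) ∂(Measure.pi μ) =
      ENNReal.ofReal (∏ k, ∫ x, f k x ∂(μ k)) := by
  have hae : ∀ᵐ x ∂(Measure.pi μ), ∀ k, 0 ≤ f k (x k) :=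
    eventually_countable_forall.mpr fun k => (Measure.quasiMeasurePreserving_eval (μ := μ) k).ae (h0 k)
  rw [← integral_fintype_prod_eq_prod, ofReal_integral_eq_lintegral_ofReal]
  · refine lintegral_congr_ae (hae.mono fun x hx => ?_)
    exact (ENNReal.ofReal_prod_of_nonneg fun k _ => hx k).symm
  · exact Integrable.fintype_prod hf
  · exact hae.mono fun x hx => Finset.prod_nonneg fun k _ => hx k

end OneVariable

/-! ### Pivot factorization of matrices supported on a rooted forest -/

section Forest

variable {V ι : Type*} [Fintype V] [DecidableEq V] [Fintype ι]

/-- The symmetric matrix with diagonal `d` and entry `t e` at the edge joining `c e` to `p e`. -/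
def forestMatrix (c p : ι → V) (d : V → ℝ) (t : ι → ℝ) : Matrix V V ℝ :=
  Matrix.diagonal d + ∑ e, (Matrix.single (c e) (p e) (t e) + Matrix.single (p e) (c e) (t e))

/-- The diagonal of the matrix with off-diagonal entries `t` whose pivots, eliminating children
before parents, are `a`. -/
noncomputable def pivotDiag (c p : ι → V) (t : ι → ℝ) (a : V → ℝ) : V → ℝ :=
  fun v => a v + ∑ e, if p e = v then t e ^ 2 / a (c e) else 0

variable {c p : ι → V} {h : V → ℕ}

theorem dotProduct_forestMatrix_mulVec (d y : V → ℝ) (t : ι → ℝ) :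
    y ⬝ᵥ (forestMatrix c p d t *ᵥ y) =
      ∑ v, d v * y v ^ 2 + ∑ e, 2 * t e * (y (c e) * y (p e)) := by
  have h1 : ∀ i j (x : ℝ), y ⬝ᵥ (Matrix.single i j x *ᵥ y) = x * (y i * y j) := by
    intro i j x
    simp only [dotProduct, Matrix.mulVec, Matrix.single_apply, ite_mul, zero_mul]
    simp [ite_and]
    ring
  rw [forestMatrix, Matrix.add_mulVec, dotProduct_add, Matrix.sum_mulVec, dotProduct_sum]
  congr 1
  · simp only [dotProduct, Matrix.mulVec_diagonal]
    exact Finset.sum_congr rfl fun v _ => by ring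
  · refine Finset.sum_congr rfl fun e _ => ?_
    rw [Matrix.add_mulVec, dotProduct_add, h1, h1]
    ring

theorem trace_mul_forestMatrix {D : Matrix V V ℝ} (hD : Dᵀ = D) (d : V → ℝ) (t : ι → ℝ) :
    (D * forestMatrix c p d t).trace = ∑ v, D v v * d v + ∑ e, 2 * t e * D (c e) (p e) := by
  have h1 : ∀ i j (x : ℝ), (D * Matrix.single i j x).trace = x * D j i := by
    intro i j x
    rw [Matrix.trace_mul_single]
    simp [mul_comm]
  have h2 : ∀ i j, D j i = D i j := fun i j => congrFun (congrFun hD i) j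
  rw [forestMatrix, Matrix.mul_add, Matrix.trace_add, Matrix.mul_sum, Matrix.trace_sum]
  congr 1
  · simp [Matrix.trace, Matrix.mul_diagonal]
  · refine Finset.sum_congr rfl fun e _ => ?_
    rw [Matrix.mul_add, Matrix.trace_add, h1, h1, h2]
    ring

theorem sum_mul_pivotDiag (t : ι → ℝ) (a z : V → ℝ) :
    ∑ v, z v * pivotDiag c p t a v = ∑ v, z v * a v + ∑ e, z (p e) * (t e ^ 2 / a (c e)) := by
  simp only [pivotDiag, mul_add, Finset.sum_add_distrib, Finset.mul_sum]
  rw [Finset.sum_comm]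
  simp

/-- The unitriangular factor of a forest matrix. -/
noncomputable def pivotFactor (c p : ι → V) (t : ι → ℝ) (a : V → ℝ) : Matrix V V ℝ :=
  1 + ∑ e, Matrix.single (c e) (p e) (t e / a (c e))

theorem det_pivotFactor (hh : ∀ e, h (p e) < h (c e)) (t : ι → ℝ) (a : V → ℝ) :
    (pivotFactor c p t a).det = 1 := by
  rw [← Matrix.det_transpose, pivotFactor, Matrix.transpose_add, Matrix.transpose_one,
    ← sub_neg_eq_add]
  refine Matrix.det_one_sub_eq_one_of_rank _ h fun i j hij => ?_
  rw [Matrix.neg_apply, neg_ne_zero, Matrix.transpose_apply, Matrix.sum_apply] at hij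
  obtain ⟨e, -, he⟩ := Finset.exists_ne_zero_of_sum_ne_zero hij
  rw [Matrix.single_apply] at he
  split_ifs at he with hcp
  · rw [← hcp.1, ← hcp.2]
    exact hh e
  · exact absurd rfl he

/-- With `L = 1 + B` and `A = diag(a)`, the product is `A + AB + BᵀA + BᵀAB`. The middle terms carry
the edge entries. The last is diagonal because a vertex has at most one parent (`c` injective), so
distinct edges do not interact: elimination creates no fill-in. -/
theorem forestMatrix_pivotDiag (hc : Function.Injective c) (t : ι → ℝ) {a : V → ℝ}
    (ha : ∀ v, a v ≠ 0) :
    forestMatrix c p (pivotDiag c p t a) t =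
      (pivotFactor c p t a)ᵀ * Matrix.diagonal a * pivotFactor c p t a := by
  classical
  have h1 : ∀ e, a (c e) * (t e / a (c e)) = t e := fun e => mul_div_cancel₀ _ (ha _)
  have h1' : ∀ e, t e / a (c e) * a (c e) = t e := fun e => div_mul_cancel₀ _ (ha _)
  have hdiag : Matrix.diagonal (pivotDiag c p t a) =
      Matrix.diagonal a + ∑ e, Matrix.single (p e) (p e) (t e ^ 2 / a (c e)) := by
    ext i j
    by_cases hij : i = j
    · subst hij
      simp [pivotDiag, Matrix.sum_apply, Matrix.single_apply]
    · rw [Matrix.diagonal_apply_ne _ hij, Matrix.add_apply, Matrix.diagonal_apply_ne _ hij,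
        Matrix.sum_apply, Finset.sum_eq_zero, add_zero]
      intro e _
      rw [Matrix.single_apply, if_neg]
      rintro ⟨rfl, rfl⟩
      exact hij rfl
  have hAB : Matrix.diagonal a * ∑ e, Matrix.single (c e) (p e) (t e / a (c e)) =
      ∑ e, Matrix.single (c e) (p e) (t e) := by
    rw [Matrix.mul_sum]
    refine Finset.sum_congr rfl fun e _ => ?_
    ext i j
    rw [Matrix.diagonal_mul, Matrix.single_apply, Matrix.single_apply]
    split_ifs with hij
    · rw [← hij.1, h1]
    · rw [mul_zero]
  have hBA : (∑ e, Matrix.single (p e) (c e) (t e / a (c e))) * Matrix.diagonal a =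
      ∑ e, Matrix.single (p e) (c e) (t e) := by
    rw [Matrix.sum_mul]
    refine Finset.sum_congr rfl fun e _ => ?_
    ext i j
    rw [Matrix.mul_diagonal, Matrix.single_apply, Matrix.single_apply]
    split_ifs with hij
    · rw [← hij.2, h1']
    · rw [zero_mul]
  have hBAB : (∑ e, Matrix.single (p e) (c e) (t e)) *
      (∑ e, Matrix.single (c e) (p e) (t e / a (c e))) =
      ∑ e, Matrix.single (p e) (p e) (t e ^ 2 / a (c e)) := by
    rw [Matrix.sum_mul]
    refine Finset.sum_congr rfl fun e _ => ?_
    rw [Matrix.mul_sum, Finset.sum_eq_single e]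
    · rw [Matrix.single_mul_single_same]
      congr 1
      ring
    · intro e' _ he'
      exact Matrix.single_mul_single_of_ne _ _ _ _ (fun hce => he' (hc hce).symm) _
    · simp
  have hT : (pivotFactor c p t a)ᵀ = 1 + ∑ e, Matrix.single (p e) (c e) (t e / a (c e)) := by
    simp [pivotFactor, Matrix.transpose_sum, Matrix.transpose_single]
  rw [hT, pivotFactor, forestMatrix, hdiag, Matrix.add_mul, Matrix.one_mul, Matrix.mul_add,
    Matrix.mul_one, Matrix.add_mul, hAB, hBA, hBAB, Finset.sum_add_distrib]
  abel

theorem det_forestMatrix_pivotDiag (hh : ∀ e, h (p e) < h (c e)) (hc : Function.Injective c)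
    (t : ι → ℝ) {a : V → ℝ} (ha : ∀ v, a v ≠ 0) :
    (forestMatrix c p (pivotDiag c p t a) t).det = ∏ v, a v := by
  rw [forestMatrix_pivotDiag hc t ha, Matrix.det_mul, Matrix.det_mul, Matrix.det_transpose,
    det_pivotFactor hh, Matrix.det_diagonal, one_mul, mul_one]

theorem posDef_forestMatrix_pivotDiag (hh : ∀ e, h (p e) < h (c e)) (hc : Function.Injective c)
    (t : ι → ℝ) {a : V → ℝ} (ha : ∀ v, 0 < a v) :
    (forestMatrix c p (pivotDiag c p t a) t).PosDef := by
  rw [forestMatrix_pivotDiag hc t fun v => (ha v).ne',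
    ← Matrix.conjTranspose_eq_transpose_of_trivial]
  refine (Matrix.PosDef.diagonal ha).conjTranspose_mul_mul_same ?_
  refine Matrix.mulVec_injective_of_isUnit ?_
  rw [Matrix.isUnit_iff_isUnit_det, det_pivotFactor hh]
  exact isUnit_one

/-- The equations are solved from the highest rank down, since the pivot at `v` depends only on
those of its children. Vanishing pivots do no harm because `x / 0 = 0`; positivity is proved
separately. -/
theorem exists_pivotDiag_eq (hh : ∀ e, h (p e) < h (c e)) (t : ι → ℝ) (d : V → ℝ) :
    ∃ a, pivotDiag c p t a = d := by
  obtain ⟨N, hN⟩ : ∃ N, ∀ v, h v < N :=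
    ⟨∑ v, h v + 1, fun v => Nat.lt_succ_of_le (Finset.single_le_sum (fun _ _ => Nat.zero_le _)
      (Finset.mem_univ v))⟩
  -- `k` counts the top rank levels already solved.
  suffices key : ∀ k ≤ N, ∃ a, ∀ v, N - k ≤ h v → pivotDiag c p t a v = d v by
    obtain ⟨a, ha⟩ := key N le_rfl
    exact ⟨a, funext fun v => ha v (by omega)⟩
  intro k
  induction k with
  | zero => exact fun _ => ⟨d, fun v hv => absurd (hN v) (by omega)⟩
  | succ k ih =>
    intro hk
    obtain ⟨a, ha⟩ := ih (by omega)
    let a' : V → ℝ := fun v => if h v = N - (k + 1) then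
      d v - ∑ e, (if p e = v then t e ^ 2 / a (c e) else 0) else a v
    have hsum : ∀ v, N - (k + 1) ≤ h v →
        (∑ e, if p e = v then t e ^ 2 / a' (c e) else 0) =
          ∑ e, if p e = v then t e ^ 2 / a (c e) else 0 := by
      intro v hv
      refine Finset.sum_congr rfl fun e _ => ?_
      split_ifs with hp
      · have := hh e
        rw [hp] at this
        simp only [a']
        rw [if_neg (by omega)]
      · rfl
    refine ⟨a', fun v hv => ?_⟩
    rw [pivotDiag, hsum v hv]
    by_cases hvk : h v = N - (k + 1)
    · simp [a', hvk]
    · rw [← ha v (by omega), pivotDiag]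
      simp [a', hvk]

theorem pivotDiag_injective (hh : ∀ e, h (p e) < h (c e)) (t : ι → ℝ) :
    Function.Injective (pivotDiag c p t) := by
  intro a a' haa
  obtain ⟨N, hN⟩ : ∃ N, ∀ v, h v < N :=
    ⟨∑ v, h v + 1, fun v => Nat.lt_succ_of_le (Finset.single_le_sum (fun _ _ => Nat.zero_le _)
      (Finset.mem_univ v))⟩
  suffices key : ∀ (k : ℕ) (v : V), N - h v = k → a v = a' v from funext fun v => key _ v rfl
  intro k
  induction k using Nat.strong_induction_on with
  | _ k ih =>
    intro v hv
    have hsum : (∑ e, if p e = v then t e ^ 2 / a (c e) else 0) =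
        ∑ e, if p e = v then t e ^ 2 / a' (c e) else 0 := by
      refine Finset.sum_congr rfl fun e _ => ?_
      split_ifs with hp
      · have h1 := hh e
        have h2 := hN (c e)
        rw [hp] at h1
        rw [ih (N - h (c e)) (by omega) (c e) rfl]
      · rfl
    have := congrFun haa v
    rw [pivotDiag, pivotDiag, hsum] at this
    exact add_right_cancel this

/-- Downward induction on the rank. With positive pivots above `v`, there is a vector `y` such that
formally `L y = e_v`, and the quadratic form at `y` equals `a v`. Pivots of lower rank may still
vanish at this stage, so the form is evaluated directly instead of through the factorization. -/
theorem pos_of_posDef_pivotDiag (hh : ∀ e, h (p e) < h (c e)) (t : ι → ℝ) (a : V → ℝ)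
    (hP : (forestMatrix c p (pivotDiag c p t a) t).PosDef) (hc : Function.Injective c) (v : V) :
    0 < a v := by
  classical
  obtain ⟨N, hN⟩ : ∃ N, ∀ v, h v < N :=
    ⟨∑ v, h v + 1, fun v => Nat.lt_succ_of_le (Finset.single_le_sum (fun _ _ => Nat.zero_le _)
      (Finset.mem_univ v))⟩
  induction hk : N - h v using Nat.strong_induction_on generalizing v with
  | _ k ih =>
    have hpos : ∀ w, h v < h w → 0 < a w := fun w hw => by
      have := hN w
      exact ih (N - h w) (by omega) w rfl
    -- The value 1 at `v` is propagated to higher ranks by `a w * y w = -(t e * y (p e))` along the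
    -- edge with child `w`, dividing by pivots already known to be positive.
    obtain ⟨y, hyv, hy0, hys⟩ : ∃ y : V → ℝ, y v = 1 ∧ (∀ w, h w ≤ h v → w ≠ v → y w = 0) ∧
        ∀ w, h v < h w → a w * y w + ∑ e, (if c e = w then t e * y (p e) else 0) = 0 := by
      suffices key : ∀ k, ∃ y : V → ℝ, y v = 1 ∧ (∀ w, h w ≤ h v → w ≠ v → y w = 0) ∧
          ∀ w, h v < h w → h w < k →
            a w * y w + ∑ e, (if c e = w then t e * y (p e) else 0) = 0 by
        obtain ⟨y, h1, h2, h3⟩ := key N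
        exact ⟨y, h1, h2, fun e he => h3 e he (hN _)⟩
      intro k
      induction k with
      | zero => exact ⟨fun w => if w = v then 1 else 0, by simp, fun w _ hw => by simp [hw],
          fun e _ he => absurd he (by omega)⟩
      | succ k ihk =>
        obtain ⟨y, h1, h2, h3⟩ := ihk
        let y' : V → ℝ := fun w => if h v < h w ∧ h w = k then
          -(∑ e, (if c e = w then t e * y (p e) else 0)) / a w else y w
        refine ⟨y', ?_, ?_, ?_⟩
        · simp [y', h1]
        · intro w hw hwv
          simp only [y']
          rw [if_neg (by omega)]
          exact h2 w hw hwv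
        · intro w hw hwk
          have hsum : ∑ e, (if c e = w then t e * y' (p e) else 0) =
              ∑ e, (if c e = w then t e * y (p e) else 0) := by
            refine Finset.sum_congr rfl fun e _ => ?_
            split_ifs with hce
            · have hpe := hh e
              rw [hce] at hpe
              simp only [y']
              rw [if_neg (by omega)]
            · rfl
          rw [hsum]
          by_cases hk : h w = k
          · simp only [y']
            rw [if_pos ⟨hw, hk⟩, mul_div_cancel₀ _ (hpos w hw).ne', neg_add_cancel]
          · simp only [y']
            rw [if_neg fun hh => hk hh.2]
            exact h3 w hw (by omega)
    have hye : ∀ e, h v < h (c e) → a (c e) * y (c e) + t e * y (p e) = 0 := by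
      intro e he
      rw [← hys _ he, Finset.sum_eq_single e]
      · simp
      · intro e' _ hne
        rw [if_neg fun hce => hne (hc hce)]
      · simp
    have hq := hP.dotProduct_mulVec_pos (x := y) (fun h0 => by simp [h0] at hyv)
    rw [star_trivial, dotProduct_forestMatrix_mulVec] at hq
    have hsq : ∑ w, pivotDiag c p t a w * y w ^ 2 =
        ∑ w, a w * y w ^ 2 + ∑ e, y (p e) ^ 2 * (t e ^ 2 / a (c e)) := by
      rw [← Finset.sum_congr rfl fun w _ => mul_comm (y w ^ 2) (pivotDiag c p t a w),
        sum_mul_pivotDiag]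
      congr 1
      exact Finset.sum_congr rfl fun w _ => mul_comm _ _
    rw [hsq] at hq
    have hedge : ∀ e, y (p e) ^ 2 * (t e ^ 2 / a (c e)) + 2 * t e * (y (c e) * y (p e)) =
        if h v < h (c e) then y (c e) * (t e * y (p e)) else 0 := by
      intro e
      split_ifs with he
      · have h2 := (hpos _ he).ne'
        have h3 : t e * y (p e) = - (a (c e) * y (c e)) := by linarith [hye e he]
        have h4 : y (p e) ^ 2 * (t e ^ 2 / a (c e)) = a (c e) * y (c e) ^ 2 := by
          rw [mul_div_assoc', ← mul_pow, mul_comm (y (p e)), h3]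
          field_simp
        rw [h4]
        linear_combination y (c e) * h3
      · have h0 : y (p e) = 0 := by
          have := hh e
          refine hy0 _ (by omega) ?_
          intro hpv
          rw [hpv] at this
          omega
        simp [h0]
    -- Above `v`, each vertex term cancels against the term of the edge to its parent; only `a v`
    -- survives.
    have hvert : ∀ w, a w * y w ^ 2 = (if w = v then a v else 0) -
        ∑ e, if c e = w then (if h v < h (c e) then y (c e) * (t e * y (p e)) else 0) else 0 := by
      intro w
      by_cases hw : h v < h w
      · have hwv : w ≠ v := by rintro rfl; exact lt_irrefl _ hw
        have : ∑ e, (if c e = w then (if h v < h (c e) then y (c e) * (t e * y (p e)) else 0)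
            else 0) = y w * ∑ e, (if c e = w then t e * y (p e) else 0) := by
          rw [Finset.mul_sum]
          refine Finset.sum_congr rfl fun e _ => ?_
          split_ifs with h1 h2 <;> simp_all
        rw [this, if_neg hwv]
        linear_combination y w * hys w hw
      · rw [Finset.sum_eq_zero, sub_zero]
        · split_ifs with hwv
          · rw [hwv, hyv]
            ring
          · rw [hy0 w (by omega) hwv]
            ring
        · intro e _
          split_ifs with h1 h2
          · rw [h1] at h2
            exact absurd h2 hw
          · rfl
          · rfl
    rw [add_assoc, ← Finset.sum_add_distrib, Finset.sum_congr rfl fun e _ => hedge e,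
      Finset.sum_congr rfl fun w _ => hvert w, Finset.sum_sub_distrib, Finset.sum_comm] at hq
    simpa using hq

end Forest

/-! ### Lebesgue measure in pivot coordinates -/

section ChangeOfVariables

variable {V ι : Type*} [Fintype V] [DecidableEq V] [Fintype ι] {c p : ι → V} {h : V → ℕ}

/-- The Jacobian matrix of `pivotDiag` at `a` is `1 - pivotJacobian c p t a`. -/
noncomputable def pivotJacobian (c p : ι → V) (t : ι → ℝ) (a : V → ℝ) : Matrix V V ℝ :=
  Matrix.of fun v w => ∑ e, if p e = v then (if c e = w then t e ^ 2 / a (c e) ^ 2 else 0) else 0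

/-- A diagonal entry depends on its own pivot with slope 1 and otherwise only on pivots of higher
rank. -/
theorem det_one_sub_pivotJacobian (hh : ∀ e, h (p e) < h (c e)) (t : ι → ℝ) (a : V → ℝ) :
    (1 - pivotJacobian c p t a).det = 1 := by
  refine Matrix.det_one_sub_eq_one_of_rank _ h fun i j hij => ?_
  rw [pivotJacobian, Matrix.of_apply] at hij
  obtain ⟨e, -, he⟩ := Finset.exists_ne_zero_of_sum_ne_zero hij
  split_ifs at he with hp hc
  · rw [← hp, ← hc]
    exact hh e
  · exact absurd rfl he
  · exact absurd rfl he

theorem hasFDerivAt_pivotDiag (t : ι → ℝ) {a : V → ℝ} (ha : ∀ v, a v ≠ 0) :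
    HasFDerivAt (pivotDiag c p t)
      (LinearMap.toContinuousLinearMap (Matrix.toLin' (1 - pivotJacobian c p t a))) a := by
  rw [hasFDerivAt_pi']
  intro v
  have hterm : ∀ e, HasFDerivAt (fun a : V → ℝ => if p e = v then t e ^ 2 / a (c e) else 0)
      (if p e = v then (-(t e ^ 2 / a (c e) ^ 2)) • ContinuousLinearMap.proj (R := ℝ)
        (φ := fun _ : V => ℝ) (c e) else 0) a := by
    intro e
    split_ifs
    · have h1 : HasDerivAt (fun x : ℝ => t e ^ 2 / x) (-(t e ^ 2 / a (c e) ^ 2)) (a (c e)) := by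
        simpa [div_eq_mul_inv] using (hasDerivAt_inv (ha (c e))).const_mul (t e ^ 2)
      exact h1.comp_hasFDerivAt a (hasFDerivAt_apply (𝕜 := ℝ) (c e) a)
    · exact hasFDerivAt_const _ _
  have hsum := (hasFDerivAt_apply (𝕜 := ℝ) (F' := fun _ : V => ℝ) v a).add
    (HasFDerivAt.fun_sum (u := Finset.univ) fun e _ => hterm e)
  refine HasFDerivAt.congr_fderiv hsum ?_
  ext x
  symm
  change (Matrix.toLin' (1 - pivotJacobian c p t a) x) v = _
  rw [Matrix.toLin'_apply, Matrix.sub_mulVec, Matrix.one_mulVec, add_apply, sum_apply,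
    Pi.sub_apply, sub_eq_add_neg]
  congr 1
  simp only [pivotJacobian, Matrix.mulVec, dotProduct, Matrix.of_apply, Finset.sum_mul]
  rw [Finset.sum_comm, ← Finset.sum_neg_distrib]
  refine Finset.sum_congr rfl fun e _ => ?_
  split_ifs <;> simp

theorem setOf_posDef_forestMatrix (hh : ∀ e, h (p e) < h (c e)) (hc : Function.Injective c)
    (t : ι → ℝ) : {d | (forestMatrix c p d t).PosDef} =
      pivotDiag c p t '' (Set.univ.pi fun _ => Set.Ioi 0) := by
  ext d
  constructor
  · intro hd
    obtain ⟨a, rfl⟩ := exists_pivotDiag_eq hh t d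
    exact ⟨a, fun v _ => pos_of_posDef_pivotDiag hh t a hd hc v, rfl⟩
  · rintro ⟨a, ha, rfl⟩
    exact posDef_forestMatrix_pivotDiag hh hc t fun v => ha v trivial

/-- The set is the image of a Borel set under an injective map continuous on it, hence Borel by
Lusin–Souslin. -/
theorem measurableSet_posDef_forestMatrix (hh : ∀ e, h (p e) < h (c e))
    (hc : Function.Injective c) :
    MeasurableSet {θ : (V → ℝ) × (ι → ℝ) | (forestMatrix c p θ.1 θ.2).PosDef} := by
  have himg : {θ : (V → ℝ) × (ι → ℝ) | (forestMatrix c p θ.1 θ.2).PosDef} =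
      (fun θ : (V → ℝ) × (ι → ℝ) => (pivotDiag c p θ.2 θ.1, θ.2)) ''
        ((Set.univ.pi fun _ => Set.Ioi 0) ×ˢ Set.univ) := by
    ext ⟨d, t⟩
    have := Set.ext_iff.mp (setOf_posDef_forestMatrix hh hc t) d
    simp only [Set.mem_ofPred_eq] at this ⊢
    rw [this]
    constructor
    · rintro ⟨a, ha, rfl⟩
      exact ⟨(a, t), ⟨ha, trivial⟩, rfl⟩
    · rintro ⟨⟨a, t'⟩, ⟨ha, -⟩, heq⟩
      obtain ⟨h1, h2⟩ := Prod.mk.inj heq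
      subst h2
      exact ⟨a, ha, h1⟩
  rw [himg]
  refine MeasurableSet.image_of_continuousOn_injOn
    ((MeasurableSet.univ_pi fun _ => measurableSet_Ioi).prod MeasurableSet.univ) ?_ ?_
  · refine ContinuousOn.prodMk (continuousOn_pi.mpr fun v => ?_) continuousOn_snd
    refine ContinuousOn.add (by fun_prop) (continuousOn_finsetSum _ fun e _ => ?_)
    split_ifs
    · refine ContinuousOn.div (by fun_prop) (by fun_prop) fun θ hθ => ?_
      exact (hθ.1 (c e) trivial).ne'
    · exact continuousOn_const
  · rintro ⟨a, t⟩ - ⟨a', t'⟩ - heq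
    obtain ⟨h1, h2⟩ := Prod.mk.inj heq
    simp only at h1 h2
    subst h2
    rw [pivotDiag_injective hh t h1]

theorem setLIntegral_posDef_forestMatrix (hh : ∀ e, h (p e) < h (c e))
    (hc : Function.Injective c) {G : (V → ℝ) × (ι → ℝ) → ENNReal} (hG : Measurable G) :
    ∫⁻ θ in {θ : (V → ℝ) × (ι → ℝ) | (forestMatrix c p θ.1 θ.2).PosDef}, G θ
        ∂((volume : Measure (V → ℝ)).prod (volume : Measure (ι → ℝ))) =
      ∫⁻ t : ι → ℝ, ∫⁻ a in Set.univ.pi fun _ : V => Set.Ioi (0 : ℝ), G (pivotDiag c p t a, t) := by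
  have hP := measurableSet_posDef_forestMatrix hh hc
  rw [← lintegral_indicator hP, lintegral_prod_symm' _ (hG.indicator hP)]
  refine lintegral_congr fun t => ?_
  have hO : MeasurableSet (Set.univ.pi fun _ : V => Set.Ioi (0 : ℝ)) :=
    MeasurableSet.univ_pi fun _ => measurableSet_Ioi
  have hder : ∀ a ∈ Set.univ.pi fun _ : V => Set.Ioi (0 : ℝ), HasFDerivWithinAt (pivotDiag c p t)
      (LinearMap.toContinuousLinearMap (Matrix.toLin' (1 - pivotJacobian c p t a)))
      (Set.univ.pi fun _ : V => Set.Ioi (0 : ℝ)) a := fun a ha =>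
    (hasFDerivAt_pivotDiag t fun v => (ha v trivial).ne').hasFDerivWithinAt
  have hinj : Set.InjOn (pivotDiag c p t) (Set.univ.pi fun _ : V => Set.Ioi (0 : ℝ)) :=
    (pivotDiag_injective hh t).injOn
  have hcv := lintegral_image_eq_lintegral_abs_det_fderiv_mul volume hO hder hinj
    fun d => G (d, t)
  rw [← setOf_posDef_forestMatrix hh hc t] at hcv
  have hPt : MeasurableSet {d | (forestMatrix c p d t).PosDef} := measurable_prodMk_right hP
  rw [← lintegral_indicator hPt] at hcv
  refine Eq.trans (lintegral_congr fun d => ?_) (hcv.trans (lintegral_congr fun a => ?_))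
  · rfl
  · rw [ContinuousLinearMap.det, LinearMap.coe_toContinuousLinearMap, LinearMap.det_toLin',
      det_one_sub_pivotJacobian hh]
    simp

end ChangeOfVariables

/-! ### Normalizing constant for a rooted forest -/

section ForestIntegral

variable {V ι : Type*} [Fintype V] [DecidableEq V] [Fintype ι] {c p : ι → V} {h : V → ℕ}

/-- The normalizing constant of the scalar kernel `a ^ ((δ - 2) / 2) * exp (-d * a / 2)`. -/
noncomputable def vertexConst (δ d : ℝ) : ℝ := (2 / d) ^ (δ / 2) * Real.Gamma (δ / 2)

theorem continuous_forestMatrix :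
    Continuous fun θ : (V → ℝ) × (ι → ℝ) => forestMatrix c p θ.1 θ.2 := by
  refine continuous_matrix fun i j => ?_
  simp only [forestMatrix, Matrix.add_apply, Matrix.sum_apply, Matrix.single_apply,
    Matrix.diagonal_apply]
  refine Continuous.add ?_ (continuous_finsetSum _ fun e _ => Continuous.add ?_ ?_) <;>
    split_ifs <;> fun_prop

theorem det_submatrix_pair_pos {D : Matrix V V ℝ} (hD : D.PosDef) {i j : V} (hij : i ≠ j) :
    0 < (D.submatrix ![i, j] ![i, j]).det := by
  refine (hD.submatrix ?_).det_pos
  intro k l hkl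
  fin_cases k <;> fin_cases l <;> simp_all [hij.symm]

/-- The factor of an edge joining `i` to its parent `j`: the off-diagonal entry has been integrated
out, and `a` is the pivot of `i`. -/
theorem edge_integral {δ : ℝ} (hδ : 0 < δ) {D : Matrix V V ℝ} (hD : D.PosDef) {i j : V}
    (hij : i ≠ j) :
    Integrable (fun a : ℝ => a ^ ((δ - 2) / 2) * Real.exp (-(1 / 2) * (D i i * a)) *
      (√(2 * Real.pi / D j j) * a ^ (1 / 2 : ℝ) * Real.exp (a * (D i j ^ 2 / (2 * D j j)))))
      (volume.restrict (Set.Ioi 0)) ∧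
    ∫ a in Set.Ioi (0 : ℝ), a ^ ((δ - 2) / 2) * Real.exp (-(1 / 2) * (D i i * a)) *
      (√(2 * Real.pi / D j j) * a ^ (1 / 2 : ℝ) * Real.exp (a * (D i j ^ 2 / (2 * D j j)))) =
      vertexConst δ (D i i) * (2 * √Real.pi * g δ D i j) := by
  have hi : 0 < D i i := hD.diag_pos
  have hj : 0 < D j j := hD.diag_pos
  have hji : D j i = D i j := by simpa using hD.isHermitian.apply i j
  have hdet := det_submatrix_pair_pos hD hij
  have hdet' : (D.submatrix ![i, j] ![i, j]).det = D i i * D j j - D i j ^ 2 := by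
    rw [Matrix.det_fin_two]
    simp [hji, sq]
  set q := (D.submatrix ![i, j] ![i, j]).det with hq
  have hs : 0 < (δ + 1) / 2 := by positivity
  have hr : 0 < q / (2 * D j j) := by positivity
  have hint := integrable_rpow_mul_exp hs hr
  -- The exponents of `a` add up to `(δ + 1) / 2 - 1`, and the rate is `D i i / 2 - D i j ^ 2 / (2 *
  -- D j j) = q / (2 * D j j)`: a Gamma integral.
  have hfun : Set.EqOn (fun a : ℝ => √(2 * Real.pi / D j j) *
      (a ^ ((δ + 1) / 2 - 1) * Real.exp (-(q / (2 * D j j) * a))))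
      (fun a : ℝ => a ^ ((δ - 2) / 2) * Real.exp (-(1 / 2) * (D i i * a)) *
      (√(2 * Real.pi / D j j) * a ^ (1 / 2 : ℝ) * Real.exp (a * (D i j ^ 2 / (2 * D j j)))))
      (Set.Ioi 0) := by
    intro a ha
    have h1 : a ^ ((δ + 1) / 2 - 1) = a ^ ((δ - 2) / 2) * a ^ (1 / 2 : ℝ) := by
      rw [← Real.rpow_add ha]
      congr 1
      ring
    have h2 : Real.exp (-(q / (2 * D j j) * a)) =
        Real.exp (-(1 / 2) * (D i i * a)) * Real.exp (a * (D i j ^ 2 / (2 * D j j))) := by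
      rw [← Real.exp_add, hdet']
      congr 1
      field_simp
      ring
    simp only [h1, h2]
    ring
  constructor
  · exact (hint.1.const_mul √(2 * Real.pi / D j j)).congr
      ((ae_restrict_iff' measurableSet_Ioi).mpr (Filter.Eventually.of_forall hfun))
  · rw [← setIntegral_congr_fun measurableSet_Ioi hfun, integral_const_mul, hint.2, vertexConst, g,
      ← hq]
    have hΓ := (Real.Gamma_pos_of_pos (by positivity : 0 < δ / 2)).ne'
    have e1 : √(2 * Real.pi / D j j) = √Real.pi * (2 ^ (1 / 2 : ℝ) / D j j ^ (1 / 2 : ℝ)) := by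
      rw [← Real.div_rpow (by norm_num) hj.le, ← Real.sqrt_eq_rpow, ← Real.sqrt_mul (by positivity)]
      congr 1
      ring
    have e2 : (1 / (q / (2 * D j j))) ^ ((δ + 1) / 2) =
        2 ^ (δ / 2) * 2 ^ (1 / 2 : ℝ) * (D j j ^ (δ / 2) * D j j ^ (1 / 2 : ℝ)) /
          q ^ ((δ + 1) / 2) := by
      rw [one_div_div, Real.div_rpow (by positivity) hdet.le, Real.mul_rpow (by norm_num) hj.le,
        ← Real.rpow_add (by norm_num), ← Real.rpow_add hj]
      congr 3 <;> ring
    -- One root of 2 comes from the Gaussian factor and one from the Gamma integral; together they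
    -- give the 2 in `2 * √π`.
    have e3 : (2 : ℝ) ^ (1 / 2 : ℝ) * 2 ^ (1 / 2 : ℝ) = 2 := by
      rw [← Real.rpow_add (by norm_num)]
      norm_num
    rw [e1, e2, Real.div_rpow (by norm_num) hi.le, Real.mul_rpow hi.le hj.le]
    have h4 : D j j ^ (1 / 2 : ℝ) ≠ 0 := by positivity
    have h5 : D i i ^ (δ / 2) ≠ 0 := by positivity
    have h6 : q ^ ((δ + 1) / 2) ≠ 0 := by positivity
    field_simp
    linear_combination e3

theorem vertex_integral {δ d : ℝ} (hδ : 0 < δ) (hd : 0 < d) :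
    Integrable (fun a : ℝ => a ^ ((δ - 2) / 2) * Real.exp (-(1 / 2) * (d * a)))
      (volume.restrict (Set.Ioi 0)) ∧
    ∫ a in Set.Ioi (0 : ℝ), a ^ ((δ - 2) / 2) * Real.exp (-(1 / 2) * (d * a)) =
      vertexConst δ d := by
  have hs : 0 < δ / 2 := by positivity
  have hr : 0 < d / 2 := by positivity
  have := integrable_rpow_mul_exp hs hr
  have hfun : (fun t : ℝ => t ^ (δ / 2 - 1) * Real.exp (-(d / 2 * t))) =
      fun a : ℝ => a ^ ((δ - 2) / 2) * Real.exp (-(1 / 2) * (d * a)) := by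
    ext t
    congr 2
    · ring
    · ring
  rw [hfun] at this
  refine ⟨this.1, this.2.trans ?_⟩
  rw [vertexConst, one_div_div]

theorem lintegral_forest {δ : ℝ} (hδ : 0 < δ) {D : Matrix V V ℝ} (hD : D.PosDef)
    (hh : ∀ e, h (p e) < h (c e)) (hc : Function.Injective c) :
    ∫⁻ θ in {θ : (V → ℝ) × (ι → ℝ) | (forestMatrix c p θ.1 θ.2).PosDef},
        ENNReal.ofReal ((forestMatrix c p θ.1 θ.2).det ^ ((δ - 2) / 2) *
          Real.exp (-(1 / 2) * (D * forestMatrix c p θ.1 θ.2).trace))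
        ∂((volume : Measure (V → ℝ)).prod (volume : Measure (ι → ℝ))) =
      ENNReal.ofReal ((∏ v, vertexConst δ (D v v)) *
        ∏ e, (2 * √Real.pi * g δ D (c e) (p e))) := by
  classical
  have hcp : ∀ e, c e ≠ p e := fun e hcp => by
    have := hh e
    rw [hcp] at this
    exact lt_irrefl _ this
  have hDT : Dᵀ = D := by
    rw [← Matrix.conjTranspose_eq_transpose_of_trivial]
    exact hD.isHermitian
  have hdiag : ∀ v, 0 < D v v := fun v => hD.diag_pos
  have hmeas : Measurable fun θ : (V → ℝ) × (ι → ℝ) =>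
      ENNReal.ofReal ((forestMatrix c p θ.1 θ.2).det ^ ((δ - 2) / 2) *
          Real.exp (-(1 / 2) * (D * forestMatrix c p θ.1 θ.2).trace)) := by
    have hcont := continuous_forestMatrix (c := c) (p := p)
    have h1 : Measurable fun θ : (V → ℝ) × (ι → ℝ) => (forestMatrix c p θ.1 θ.2).det :=
      hcont.matrix_det.measurable
    have h2 : Measurable fun θ : (V → ℝ) × (ι → ℝ) =>
        (D * forestMatrix c p θ.1 θ.2).trace :=
      (continuous_const.matrix_mul hcont).matrix_trace.measurable
    fun_prop
  rw [setLIntegral_posDef_forestMatrix hh hc hmeas]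
  let φ : V → ℝ → ℝ := fun v a => a ^ ((δ - 2) / 2) * Real.exp (-(1 / 2) * (D v v * a))
  let ψ : ι → ℝ → ℝ → ℝ := fun e a t =>
    Real.exp (-(1 / 2) * (2 * t * D (c e) (p e) + D (p e) (p e) * (t ^ 2 / a)))
  let Ψ : ι → ℝ → ℝ := fun e a => √(2 * Real.pi / D (p e) (p e)) * a ^ (1 / 2 : ℝ) *
    Real.exp (a * (D (c e) (p e) ^ 2 / (2 * D (p e) (p e))))
  have hO : MeasurableSet (Set.univ.pi fun _ : V => Set.Ioi (0 : ℝ)) :=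
    MeasurableSet.univ_pi fun _ => measurableSet_Ioi
  have hφ0 : ∀ v a, 0 < a → 0 ≤ φ v a := fun v a ha => by positivity
  have hψ0 : ∀ e a t, 0 ≤ ψ e a t := fun e a t => (Real.exp_pos _).le
  have hΨ0 : ∀ e a, 0 < a → 0 ≤ Ψ e a := fun e a ha => by positivity
  -- In pivot coordinates the kernel couples each edge entry only to the pivot of its child.
  have hkernel : ∀ (t : ι → ℝ), ∀ a ∈ Set.univ.pi fun _ : V => Set.Ioi (0 : ℝ),
      ENNReal.ofReal ((forestMatrix c p (pivotDiag c p t a) t).det ^ ((δ - 2) / 2) *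
          Real.exp (-(1 / 2) * (D * forestMatrix c p (pivotDiag c p t a) t).trace)) =
        (∏ v, ENNReal.ofReal (φ v (a v))) * ∏ e, ENNReal.ofReal (ψ e (a (c e)) (t e)) := by
    intro t a ha
    have ha' : ∀ v, 0 < a v := fun v => ha v trivial
    rw [det_forestMatrix_pivotDiag hh hc t fun v => (ha' v).ne',
      trace_mul_forestMatrix hDT, sum_mul_pivotDiag,
      ← ENNReal.ofReal_prod_of_nonneg fun v _ => hφ0 v _ (ha' v),
      ← ENNReal.ofReal_prod_of_nonneg fun e _ => hψ0 e _ _,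
      ← ENNReal.ofReal_mul (Finset.prod_nonneg fun v _ => hφ0 v _ (ha' v))]
    congr 1
    simp only [φ, ψ]
    rw [Finset.prod_mul_distrib, ← Real.exp_sum, ← Real.exp_sum, mul_assoc, ← Real.exp_add,
      Real.finsetProd_rpow _ _ fun v _ => (ha' v).le]
    congr 2
    rw [← Finset.mul_sum, ← Finset.mul_sum, ← mul_add, Finset.sum_add_distrib]
    ring
  have hmeasφ : ∀ v, Measurable (φ v) := fun v => by
    simp only [φ]
    fun_prop
  have hmeasψ : ∀ e, Measurable fun x : ℝ × ℝ => ψ e x.1 x.2 := fun e => by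
    simp only [ψ]
    fun_prop
  have hfib : ∀ e, ∀ a : ℝ, 0 < a →
      ∫⁻ t : ℝ, ENNReal.ofReal (ψ e a t) = ENNReal.ofReal (Ψ e a) := by
    intro e a ha
    have := integrable_exp_quadratic (hdiag (p e)) (D (c e) (p e)) ha
    rw [← ofReal_integral_eq_lintegral_ofReal this.1 (Filter.Eventually.of_forall (hψ0 e a)),
      this.2]
  calc _ = ∫⁻ t : ι → ℝ, ∫⁻ a in Set.univ.pi fun _ : V => Set.Ioi (0 : ℝ),
        (∏ v, ENNReal.ofReal (φ v (a v))) * ∏ e, ENNReal.ofReal (ψ e (a (c e)) (t e)) :=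
        lintegral_congr fun t => setLIntegral_congr_fun hO (hkernel t)
    _ = ∫⁻ a in Set.univ.pi fun _ : V => Set.Ioi (0 : ℝ), ∫⁻ t : ι → ℝ,
        (∏ v, ENNReal.ofReal (φ v (a v))) * ∏ e, ENNReal.ofReal (ψ e (a (c e)) (t e)) := by
        refine lintegral_lintegral_swap (Measurable.aemeasurable ?_)
        refine Measurable.mul ?_ ?_
        · refine Finset.measurable_fun_prod _ fun v _ => Measurable.ennreal_ofReal ?_
          have : Measurable fun x : (ι → ℝ) × (V → ℝ) => x.2 v := by fun_prop
          exact (hmeasφ v).comp this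
        · refine Finset.measurable_fun_prod _ fun e _ => Measurable.ennreal_ofReal ?_
          have : Measurable fun x : (ι → ℝ) × (V → ℝ) => (x.2 (c e), x.1 e) := by fun_prop
          exact (hmeasψ e).comp this
    -- Once `t` is integrated out, each edge factor depends on one pivot and is grouped with its
    -- child, so the integrand is again a product over vertices.
    _ = ∫⁻ a in Set.univ.pi fun _ : V => Set.Ioi (0 : ℝ),
        ∏ v, ENNReal.ofReal (φ v (a v) * ∏ e with c e = v, Ψ e (a v)) := by
        refine setLIntegral_congr_fun hO fun a ha => ?_
        have ha' : ∀ v, 0 < a v := fun v => ha v trivial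
        have hmeas' : Measurable fun t : ι → ℝ => ∏ e, ENNReal.ofReal (ψ e (a (c e)) (t e)) := by
          refine Finset.measurable_fun_prod _ fun e _ => Measurable.ennreal_ofReal ?_
          have : Measurable fun t : ι → ℝ => (a (c e), t e) := by fun_prop
          exact (hmeasψ e).comp this
        rw [lintegral_const_mul _ hmeas', volume_pi, lintegral_ofReal_prod _ (fun e => ψ e (a (c e)))]
        · rw [Finset.prod_congr rfl fun v _ => ENNReal.ofReal_mul (hφ0 v _ (ha' v)),
            Finset.prod_mul_distrib]
          congr 1
          rw [← ENNReal.ofReal_prod_of_nonneg fun v _ => Finset.prod_nonneg fun e _ =>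
            hΨ0 e _ (ha' v)]
          congr 1
          rw [← Finset.prod_fiberwise Finset.univ c]
          refine Finset.prod_congr rfl fun v _ => Finset.prod_congr rfl fun e he => ?_
          rw [← (Finset.mem_filter.mp he).2]
          exact (integrable_exp_quadratic (hdiag (p e)) (D (c e) (p e)) (ha' (c e))).2
        · exact fun e =>
            (integrable_exp_quadratic (hdiag (p e)) (D (c e) (p e)) (ha' (c e))).1
        · exact fun e => Filter.Eventually.of_forall (hψ0 e _)
    _ = ENNReal.ofReal (∏ v, (vertexConst δ (D v v) *
          ∏ e with c e = v, (2 * √Real.pi * g δ D (c e) (p e)))) := by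
        have hv : ∀ v, Integrable (fun a : ℝ => φ v a * ∏ e with c e = v, Ψ e a)
            (volume.restrict (Set.Ioi 0)) ∧
            ∫ a in Set.Ioi (0 : ℝ), φ v a * ∏ e with c e = v, Ψ e a =
              vertexConst δ (D v v) *
                ∏ e with c e = v, (2 * √Real.pi * g δ D (c e) (p e)) := by
          intro v
          -- By injectivity of `c` a vertex is the child of one edge or, for a root, of none.
          by_cases hve : ∃ e, c e = v
          · obtain ⟨e, rfl⟩ := hve
            have hfilter : (Finset.univ.filter fun e' => c e' = c e) = {e} := by
              ext e'
              simp [hc.eq_iff]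
            simp only [hfilter, Finset.prod_singleton]
            exact edge_integral hδ hD (hcp e)
          · have hfilter : (Finset.univ.filter fun e' => c e' = v) = ∅ := by
              ext e'
              simpa using fun he => hve ⟨e', he⟩
            simp only [hfilter, Finset.prod_empty, mul_one]
            exact vertex_integral hδ (hdiag v)
        rw [volume_pi, Measure.restrict_pi_pi, lintegral_ofReal_prod
          (fun _ : V => volume.restrict (Set.Ioi (0 : ℝ)))
          (fun v a => φ v a * ∏ e with c e = v, Ψ e a) (fun v => (hv v).1)]
        · rw [Finset.prod_congr rfl fun v _ => (hv v).2]
        · refine fun v => (ae_restrict_iff' measurableSet_Ioi).mpr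
            (Filter.Eventually.of_forall fun a ha => ?_)
          exact mul_nonneg (hφ0 v a ha) (Finset.prod_nonneg fun e _ => hΨ0 e a ha)
    _ = _ := by
        rw [Finset.prod_mul_distrib, Finset.prod_fiberwise]

end ForestIntegral

/-! ### Hyper-Wishart law of a tree, conjugacy and the mixture -/

section TreeIntegral

variable {V : Type*} [Fintype V] [DecidableEq V]

/-- The edge factor `g δ D` as a function of the unordered pair. -/
noncomputable def edgeFactor (δ : ℝ) (D : Matrix V V ℝ) : Sym2 V → ℝ :=
  Sym2.lift ⟨g δ D, g_comm δ D⟩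

theorem edgeWeight_eq_div {n : ℕ} (δ : ℝ) (D : Matrix V V ℝ) (x : Matrix (Fin n) V ℝ)
    (e : Sym2 V) :
    edgeWeight δ D x e = edgeFactor (δ + n) (rateStar D x) e / edgeFactor δ D e := by
  induction e using Sym2.ind
  rfl

theorem g_pos {δ : ℝ} (hδ : 0 < δ) {D : Matrix V V ℝ} (hD : D.PosDef) {i j : V} (hij : i ≠ j) :
    0 < g δ D i j := by
  have h1 := det_submatrix_pair_pos hD hij
  have hi : 0 < D i i := hD.diag_pos
  have hj : 0 < D j j := hD.diag_pos
  have h2 := Real.Gamma_pos_of_pos (by positivity : 0 < δ / 2)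
  have h3 := Real.Gamma_pos_of_pos (by positivity : 0 < (δ + 1) / 2)
  rw [g]
  positivity

theorem rateStar_posDef {n : ℕ} {D : Matrix V V ℝ} (hD : D.PosDef) (x : Matrix (Fin n) V ℝ) :
    (rateStar D x).PosDef := by
  rw [rateStar, ← Matrix.conjTranspose_eq_transpose_of_trivial]
  exact hD.add_posSemidef (Matrix.posSemidef_conjTranspose_mul_self x)

theorem rateStar_apply_self {n : ℕ} (D : Matrix V V ℝ) (x : Matrix (Fin n) V ℝ) (i : V) :
    rateStar D x i i = D i i + ∑ r, x r i ^ 2 := by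
  simp [rateStar, Matrix.mul_apply, sq]

theorem edgeWeight_pos {n : ℕ} {δ : ℝ} (hδ : 0 < δ) {D : Matrix V V ℝ} (hD : D.PosDef)
    (x : Matrix (Fin n) V ℝ) {i j : V} (hij : i ≠ j) : 0 < edgeWeight δ D x s(i, j) :=
  div_pos (g_pos (by positivity) (rateStar_posDef hD x) hij) (g_pos hδ hD hij)

theorem exists_orientation {T : SimpleGraph V} (hT : T.IsTree) :
    ∃ (c p : T.edgeSet → V) (h : V → ℕ), (∀ e, h (p e) < h (c e)) ∧ Function.Injective c ∧
      ∀ e, s(c e, p e) = e.1 := by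
  obtain ⟨u⟩ := hT.connected.nonempty
  obtain ⟨f, hf, rfl⟩ := exists_isRanked_parentGraph_eq hT u
  have hex : ∀ e : (parentGraph f).edgeSet, ∃ i, s(i.1, f i) = e.1 := fun e => by
    exact (Set.ext_iff.mp hf.edgeSet_parentGraph e.1).mp e.2
  choose i hi using hex
  obtain ⟨h, hh⟩ := hf
  refine ⟨fun e => (i e).1, fun e => f (i e), h, fun e => hh _, fun e e' hee => ?_, hi⟩
  rw [Subtype.ext_iff, ← hi e, ← hi e', Subtype.ext hee]

theorem precision_eq_forestMatrix {T : SimpleGraph V} [Fintype T.edgeSet] {c p : T.edgeSet → V}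
    (hcp : ∀ e, s(c e, p e) = e.1) (θ : (V → ℝ) × (T.edgeSet → ℝ)) :
    precision T θ = forestMatrix c p θ.1 θ.2 := by
  classical
  have hne : ∀ e, c e ≠ p e := fun e => by
    have := e.2
    rw [← hcp e] at this
    exact SimpleGraph.Adj.ne this
  ext i j
  rw [precision, Matrix.of_apply, forestMatrix, Matrix.add_apply, Matrix.sum_apply]
  simp only [Matrix.add_apply, Matrix.single_apply]
  by_cases hij : i = j
  · subst hij
    rw [if_pos rfl, Matrix.diagonal_apply_eq, Finset.sum_eq_zero, add_zero]
    intro e _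
    rw [if_neg, if_neg, add_zero]
    · rintro ⟨h1, h2⟩
      exact hne e (h2.trans h1.symm)
    · rintro ⟨h1, h2⟩
      exact hne e (h1.trans h2.symm)
  · rw [if_neg hij, Matrix.diagonal_apply_ne _ hij, zero_add]
    have hterm : ∀ e : T.edgeSet, ((if c e = i ∧ p e = j then θ.2 e else 0) +
        if p e = i ∧ c e = j then θ.2 e else 0) = if e.1 = s(i, j) then θ.2 e else 0 := by
      intro e
      have hiff : e.1 = s(i, j) ↔ (c e = i ∧ p e = j) ∨ (c e = j ∧ p e = i) := by
        rw [← hcp e, Sym2.eq_iff]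
      by_cases h1 : c e = i ∧ p e = j
      · rw [if_pos h1, if_neg, if_pos (hiff.mpr (Or.inl h1)), add_zero]
        rintro ⟨h2, -⟩
        exact hij (h2.symm.trans h1.2)
      · by_cases h2 : p e = i ∧ c e = j
        · rw [if_neg h1, if_pos h2, if_pos (hiff.mpr (Or.inr h2.symm)), zero_add]
        · rw [if_neg h1, if_neg h2, if_neg, add_zero]
          intro h
          rcases hiff.mp h with h | h
          · exact h1 h
          · exact h2 h.symm
    rw [Finset.sum_congr rfl fun e _ => hterm e]
    split_ifs with hadj
    · rw [Finset.sum_eq_single ⟨s(i, j), hadj⟩]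
      · simp
      · intro e _ he
        rw [if_neg fun h => he (Subtype.ext h)]
      · simp
    · rw [Finset.sum_eq_zero]
      intro e _
      rw [if_neg]
      intro h
      exact hadj (by rw [← SimpleGraph.mem_edgeSet, ← h]; exact e.2)

/-- `entryMeasure` is built with the classical `Fintype` instance on the edge set; this moves to an
arbitrary one. -/
theorem entryMeasure_eq (T : SimpleGraph V) [Fintype T.edgeSet] :
    entryMeasure T = (volume : Measure (V → ℝ)).prod (volume : Measure (T.edgeSet → ℝ)) := by
  unfold entryMeasure
  congr!

/-- Requiring nonzero entries at the edges removes only the null hyperplanes `θ.2 e = 0`. -/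
theorem ae_mem_precisionCone_iff (T : SimpleGraph V) :
    ∀ᵐ θ ∂(entryMeasure T), θ ∈ precisionCone T ↔ (precision T θ).PosDef := by
  classical
  have hne : ∀ᵐ θ ∂(entryMeasure T), ∀ e, θ.2 e ≠ 0 := by
    rw [entryMeasure_eq]
    refine Measure.quasiMeasurePreserving_snd.ae (p := fun t : T.edgeSet → ℝ => ∀ e, t e ≠ 0) ?_
    refine eventually_countable_forall.mpr fun e => ?_
    exact Measure.quasiMeasurePreserving_eval (μ := fun _ : T.edgeSet => (volume : Measure ℝ)) e
      |>.ae (Measure.ae_ne volume 0)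
  filter_upwards [hne] with θ hθ
  refine ⟨fun h => h.1, fun h => ⟨h, fun i j hij => ?_⟩⟩
  rw [precision, Matrix.of_apply, if_neg hij]
  split_ifs with hadj
  · simp [hadj, hθ]
  · simp [hadj]

/-- The normalizing constant of the hyper-Wishart law of a tree. -/
noncomputable def treeConst (T : SimpleGraph V) [Fintype T.edgeSet] (δ : ℝ) (D : Matrix V V ℝ) :
    ℝ :=
  (∏ v, vertexConst δ (D v v)) * ∏ e ∈ T.edgeFinset, (2 * √Real.pi * edgeFactor δ D e)

theorem vertexConst_pos {δ d : ℝ} (hδ : 0 < δ) (hd : 0 < d) : 0 < vertexConst δ d := by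
  have := Real.Gamma_pos_of_pos (by positivity : 0 < δ / 2)
  rw [vertexConst]
  positivity

theorem edgeFactor_pos {T : SimpleGraph V} [Fintype T.edgeSet] {δ : ℝ} (hδ : 0 < δ)
    {D : Matrix V V ℝ} (hD : D.PosDef) {e : Sym2 V} (he : e ∈ T.edgeFinset) :
    0 < edgeFactor δ D e := by
  induction e using Sym2.ind with
  | _ i j => exact g_pos hδ hD (SimpleGraph.mem_edgeFinset.mp he : T.Adj i j).ne

theorem treeConst_pos (T : SimpleGraph V) [Fintype T.edgeSet] {δ : ℝ} (hδ : 0 < δ)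
    {D : Matrix V V ℝ} (hD : D.PosDef) : 0 < treeConst T δ D := by
  refine mul_pos (Finset.prod_pos fun v _ => vertexConst_pos hδ hD.diag_pos)
    (Finset.prod_pos fun e he => ?_)
  have := edgeFactor_pos hδ hD he
  positivity

theorem hyperWishartKernel_nonneg (T : SimpleGraph V) (δ : ℝ) (D : Matrix V V ℝ) (θ) :
    0 ≤ hyperWishartKernel T δ D θ := by
  refine Set.indicator_nonneg (fun θ hθ => ?_) θ
  have := hθ.1.det_pos
  positivity

theorem integrable_hyperWishartKernel {T : SimpleGraph V} [Fintype T.edgeSet] (hT : T.IsTree)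
    {δ : ℝ} (hδ : 0 < δ) {D : Matrix V V ℝ} (hD : D.PosDef) :
    Integrable (hyperWishartKernel T δ D) (entryMeasure T) ∧
      ∫ θ, hyperWishartKernel T δ D θ ∂(entryMeasure T) = treeConst T δ D := by
  obtain ⟨c, p, h, hh, hc, hcp⟩ := exists_orientation hT
  let P : Set ((V → ℝ) × (T.edgeSet → ℝ)) := {θ | (forestMatrix c p θ.1 θ.2).PosDef}
  have hP : MeasurableSet P := measurableSet_posDef_forestMatrix hh hc
  let F : (V → ℝ) × (T.edgeSet → ℝ) → ℝ := fun θ =>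
    (forestMatrix c p θ.1 θ.2).det ^ ((δ - 2) / 2) *
      Real.exp (-(1 / 2) * (D * forestMatrix c p θ.1 θ.2).trace)
  have hF : Measurable F := by
    have hcont := continuous_forestMatrix (c := c) (p := p)
    have h1 : Measurable fun θ : (V → ℝ) × (T.edgeSet → ℝ) => (forestMatrix c p θ.1 θ.2).det :=
      hcont.matrix_det.measurable
    have h2 : Measurable fun θ : (V → ℝ) × (T.edgeSet → ℝ) =>
        (D * forestMatrix c p θ.1 θ.2).trace :=
      (continuous_const.matrix_mul hcont).matrix_trace.measurable
    fun_prop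
  have hae : hyperWishartKernel T δ D =ᵐ[entryMeasure T]
      P.indicator F := by
    filter_upwards [ae_mem_precisionCone_iff T] with θ hθ
    rw [precision_eq_forestMatrix hcp] at hθ
    by_cases hmem : θ ∈ precisionCone T
    · rw [hyperWishartKernel, Set.indicator_of_mem hmem, Set.indicator_of_mem (s := P) (hθ.mp hmem),
        precision_eq_forestMatrix hcp]
    · rw [hyperWishartKernel, Set.indicator_of_notMem hmem,
        Set.indicator_of_notMem (s := P) fun h => hmem (hθ.mpr h)]
  have hmeas : AEStronglyMeasurable (hyperWishartKernel T δ D) (entryMeasure T) :=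
    (hF.indicator hP).aestronglyMeasurable.congr hae.symm
  -- `g` is symmetric in its two vertices, so the orientation drops out of the constant.
  have hedges : ∏ e : T.edgeSet, (2 * √Real.pi * g δ D (c e) (p e)) =
      ∏ e ∈ T.edgeFinset, (2 * √Real.pi * edgeFactor δ D e) := by
    rw [SimpleGraph.edgeFinset, ← Finset.prod_set_coe]
    refine Finset.prod_congr rfl fun e _ => ?_
    rw [← hcp e]
    rfl
  have hlint : ∫⁻ θ, ENNReal.ofReal (hyperWishartKernel T δ D θ) ∂(entryMeasure T) =
      ENNReal.ofReal (treeConst T δ D) := by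
    rw [treeConst, ← hedges, ← lintegral_forest hδ hD hh hc, ← entryMeasure_eq,
      ← lintegral_indicator hP]
    refine lintegral_congr_ae ?_
    filter_upwards [hae] with θ hθ
    rw [hθ]
    by_cases hmem : θ ∈ P
    · rw [Set.indicator_of_mem hmem, Set.indicator_of_mem hmem]
    · rw [Set.indicator_of_notMem hmem, Set.indicator_of_notMem hmem, ENNReal.ofReal_zero]
  have h0 : 0 ≤ᵐ[entryMeasure T] hyperWishartKernel T δ D :=
    Filter.Eventually.of_forall (hyperWishartKernel_nonneg T δ D)
  constructor
  · rw [← lintegral_ofReal_ne_top_iff_integrable hmeas h0, hlint]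
    exact ENNReal.ofReal_ne_top
  · rw [integral_eq_lintegral_of_nonneg_ae h0 hmeas, hlint,
      ENNReal.toReal_ofReal (treeConst_pos T hδ hD).le]

theorem likelihood_eq {n : ℕ} (x : Matrix (Fin n) V ℝ) {Δ : Matrix V V ℝ} (hΔ : Δ.PosDef) :
    likelihood x Δ = (2 * Real.pi) ^ (-((n : ℝ) * Fintype.card V / 2)) *
      (Δ.det ^ ((n : ℝ) / 2) * Real.exp (-(1 / 2) * (xᵀ * x * Δ).trace)) := by
  have hdet := hΔ.det_pos
  have hunit : IsUnit Δ.det := hdet.ne'.isUnit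
  have hpi : (0 : ℝ) < 2 * Real.pi := by positivity
  have htr : (xᵀ * x * Δ).trace = ∑ r, x r ⬝ᵥ (Δ *ᵥ x r) := by
    rw [Matrix.mul_assoc, Matrix.trace_mul_comm, Matrix.trace]
    refine Finset.sum_congr rfl fun r _ => ?_
    rw [Matrix.diag_apply, Matrix.mul_assoc, dotProduct]
    rfl
  have hnorm : ((2 * Real.pi) • Δ⁻¹).det ^ (-(1 / 2) : ℝ) =
      (2 * Real.pi) ^ (-((Fintype.card V : ℝ) / 2)) * Δ.det ^ (1 / 2 : ℝ) := by
    rw [Matrix.det_smul, Matrix.det_nonsing_inv, Ring.inverse_eq_inv',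
      Real.mul_rpow (by positivity) (by positivity), Real.inv_rpow hdet.le, Real.rpow_neg hdet.le,
      inv_inv, ← Real.rpow_natCast, ← Real.rpow_mul hpi.le]
    congr 2
    ring
  simp only [likelihood, gaussianDensity, sub_zero, Matrix.nonsing_inv_nonsing_inv Δ hunit, hnorm]
  rw [Finset.prod_mul_distrib, Finset.prod_const, Finset.card_univ, Fintype.card_fin,
    ← Real.exp_sum, ← Finset.mul_sum, ← htr, mul_pow, ← Real.rpow_natCast, ← Real.rpow_mul hpi.le,
    ← Real.rpow_natCast, ← Real.rpow_mul hdet.le, mul_assoc]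
  have h1 : -((Fintype.card V : ℝ) / 2) * n = -((n : ℝ) * Fintype.card V / 2) := by ring
  have h2 : (1 / 2 : ℝ) * n = n / 2 := by ring
  rw [h1, h2]

/-- Conjugacy: on the cone the powers of the determinant and the traces add up; off the cone both
sides vanish. -/
theorem likelihood_mul_hyperWishartKernel {n : ℕ} (T : SimpleGraph V) (δ : ℝ) (D : Matrix V V ℝ)
    (x : Matrix (Fin n) V ℝ) (θ : (V → ℝ) × (T.edgeSet → ℝ)) :
    likelihood x (precision T θ) * hyperWishartKernel T δ D θ =
      (2 * Real.pi) ^ (-((n : ℝ) * Fintype.card V / 2)) *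
        hyperWishartKernel T (δ + n) (rateStar D x) θ := by
  by_cases hθ : θ ∈ precisionCone T
  · rw [hyperWishartKernel, hyperWishartKernel, Set.indicator_of_mem hθ, Set.indicator_of_mem hθ]
    have hdet := hθ.1.det_pos
    have h1 : (precision T θ).det ^ ((δ + n - 2) / 2) =
        (precision T θ).det ^ ((n : ℝ) / 2) * (precision T θ).det ^ ((δ - 2) / 2) := by
      rw [← Real.rpow_add hdet]
      congr 1
      ring
    rw [likelihood_eq x hθ.1, h1, rateStar, Matrix.add_mul, Matrix.trace_add, mul_add,
      Real.exp_add]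
    ring
  · rw [hyperWishartKernel, hyperWishartKernel, Set.indicator_of_notMem hθ,
      Set.indicator_of_notMem hθ, mul_zero, mul_zero]

theorem hyperWishartDensity_eq {T : SimpleGraph V} [Fintype T.edgeSet] (hT : T.IsTree)
    {δ : ℝ} (hδ : 0 < δ) {D : Matrix V V ℝ} (hD : D.PosDef) (θ) :
    hyperWishartDensity T δ D θ = hyperWishartKernel T δ D θ / treeConst T δ D := by
  rw [hyperWishartDensity, (integrable_hyperWishartKernel hT hδ hD).2]

theorem likelihood_mul_hyperWishartDensity {n : ℕ} {T : SimpleGraph V} [Fintype T.edgeSet]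
    (hT : T.IsTree) {δ : ℝ} (hδ : 0 < δ) {D : Matrix V V ℝ} (hD : D.PosDef)
    (x : Matrix (Fin n) V ℝ) :
    (fun θ => likelihood x (precision T θ) * hyperWishartDensity T δ D θ) = fun θ =>
      (2 * Real.pi) ^ (-((n : ℝ) * Fintype.card V / 2)) / treeConst T δ D *
        hyperWishartKernel T (δ + n) (rateStar D x) θ := by
  ext θ
  rw [hyperWishartDensity_eq hT hδ hD, mul_div_assoc', likelihood_mul_hyperWishartKernel]
  ring

theorem integrable_likelihood_mul_density {n : ℕ} {T : SimpleGraph V} (hT : T.IsTree) {δ : ℝ}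
    (hδ : 0 < δ) {D : Matrix V V ℝ} (hD : D.PosDef) (x : Matrix (Fin n) V ℝ) :
    Integrable (fun θ => likelihood x (precision T θ) * hyperWishartDensity T δ D θ)
      (entryMeasure T) := by
  classical
  rw [likelihood_mul_hyperWishartDensity hT hδ hD]
  exact (integrable_hyperWishartKernel hT (by positivity) (rateStar_posDef hD x)).1.const_mul _

/-- By conjugacy this is a ratio of two normalizing constants; the factors `2 * √π` cancel edge by
edge. -/
theorem marginalLikelihood_eq {n : ℕ} {T : SimpleGraph V} [Fintype T.edgeSet] (hT : T.IsTree)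
    {δ : ℝ} (hδ : 0 < δ) {D : Matrix V V ℝ} (hD : D.PosDef) (x : Matrix (Fin n) V ℝ) :
    marginalLikelihood T δ D x = (2 * Real.pi) ^ (-((n : ℝ) * Fintype.card V / 2)) *
      ((∏ v, vertexConst (δ + n) (rateStar D x v v)) / ∏ v, vertexConst δ (D v v)) *
        ∏ e ∈ T.edgeFinset, edgeWeight δ D x e := by
  have hprod : ∀ (ε : ℝ) (M : Matrix V V ℝ), ∏ e ∈ T.edgeFinset, (2 * √Real.pi * edgeFactor ε M e) =
      (∏ _e ∈ T.edgeFinset, (2 * √Real.pi)) * ∏ e ∈ T.edgeFinset, edgeFactor ε M e :=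
    fun ε M => Finset.prod_mul_distrib
  rw [marginalLikelihood, likelihood_mul_hyperWishartDensity hT hδ hD, integral_const_mul,
    (integrable_hyperWishartKernel hT (by positivity) (rateStar_posDef hD x)).2, treeConst,
    treeConst, Finset.prod_congr rfl fun e _ => edgeWeight_eq_div δ D x e, Finset.prod_div_distrib,
    hprod, hprod]
  have h1 : ∏ _e ∈ T.edgeFinset, (2 * √Real.pi) ≠ 0 :=
    Finset.prod_ne_zero_iff.mpr fun _ _ => by positivity
  have h2 : ∏ v, vertexConst δ (D v v) ≠ 0 :=
    (Finset.prod_pos fun v _ => vertexConst_pos hδ hD.diag_pos).ne'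
  have h3 : ∏ e ∈ T.edgeFinset, edgeFactor δ D e ≠ 0 :=
    (Finset.prod_pos fun e he => edgeFactor_pos hδ hD he).ne'
  generalize ∏ _e ∈ T.edgeFinset, (2 * √Real.pi) = C at h1 ⊢
  field_simp

theorem prod_vertexConst {δ : ℝ} {d : V → ℝ} (hd : ∀ v, 0 < d v) :
    ∏ v, vertexConst δ (d v) = 2 ^ (δ / 2 * Fintype.card V) / (∏ v, d v) ^ (δ / 2) *
      Real.Gamma (δ / 2) ^ Fintype.card V := by
  simp only [vertexConst]
  rw [Finset.prod_mul_distrib, Finset.prod_const, Finset.card_univ,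
    Real.finsetProd_rpow _ _ fun v _ => by have := hd v; positivity, Finset.prod_div_distrib,
    Finset.prod_const, Finset.card_univ,
    Real.div_rpow (by positivity) (Finset.prod_nonneg fun v _ => (hd v).le),
    ← Real.rpow_natCast, ← Real.rpow_mul (by norm_num), mul_comm (Fintype.card V : ℝ)]

theorem treeActivation_eq [Nonempty V] {n : ℕ} {δ : ℝ} (hδ : 0 < δ) {D : Matrix V V ℝ}
    (hD : D.PosDef) (x : Matrix (Fin n) V ℝ) :
    treeActivation δ D x = weightFormula δ D x (edgeWeight δ D x) := by
  classical
  have hsum : treeActivation δ D x = ((trees V).card : ℝ)⁻¹ *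
      ((2 * Real.pi) ^ (-((n : ℝ) * Fintype.card V / 2)) *
        ((∏ v, vertexConst (δ + n) (rateStar D x v v)) / ∏ v, vertexConst δ (D v v))) *
        treeSum (edgeWeight δ D x) := by
    rw [treeActivation, treeSum, Finset.mul_sum]
    refine Finset.sum_congr rfl fun T hT => ?_
    rw [marginalLikelihood_eq (by simpa [trees] using hT) hδ hD x]
    ring!
  have hD' := rateStar_posDef hD x
  rw [hsum, weightFormula, card_trees, ← zpow_neg, neg_sub,
    prod_vertexConst (fun v => hD'.diag_pos), prod_vertexConst (fun v => hD.diag_pos)]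
  congr 1
  have hp1 : 0 < ∏ v, D v v := Finset.prod_pos fun v _ => hD.diag_pos
  have hp2 : 0 < ∏ v, rateStar D x v v := Finset.prod_pos fun v _ => hD'.diag_pos
  have hΓ := (Real.Gamma_pos_of_pos (by positivity : 0 < δ / 2))
  -- The surplus power of 2 in the updated vertex constants cancels the one in `(2 * π) ^ (n * p /
  -- 2)`, leaving the power of `π` alone.
  have h2 : (2 : ℝ) ^ ((δ + n) / 2 * Fintype.card V) =
      2 ^ (δ / 2 * Fintype.card V) * 2 ^ ((n : ℝ) * Fintype.card V / 2) := by
    rw [← Real.rpow_add (by norm_num)]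
    congr 1
    ring
  rw [h2, Real.rpow_neg (by positivity), Real.mul_rpow (by norm_num) Real.pi_pos.le]
  have h3 : (2 : ℝ) ^ (δ / 2 * Fintype.card V) ≠ 0 := by positivity
  have h4 : (2 : ℝ) ^ ((n : ℝ) * Fintype.card V / 2) ≠ 0 := by positivity
  field_simp

theorem strictMono_weightFormula [Nonempty V] {n : ℕ} {δ : ℝ} (hδ : 0 < δ) {D : Matrix V V ℝ}
    (hD : D.PosDef) (x : Matrix (Fin n) V ℝ) {w w' : Sym2 V → ℝ} (hw : treeSum w < treeSum w') :
    weightFormula δ D x w < weightFormula δ D x w' := by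
  refine mul_lt_mul_of_pos_left hw ?_
  have hp1 : 0 < ∏ v, D v v := Finset.prod_pos fun v _ => hD.diag_pos
  have hp2 : 0 < ∏ v, rateStar D x v v :=
    Finset.prod_pos fun v _ => (rateStar_posDef hD x).diag_pos
  have hΓ := Real.Gamma_pos_of_pos (by positivity : 0 < δ / 2)
  have hΓ' := Real.Gamma_pos_of_pos (by positivity : 0 < (δ + n) / 2)
  have hp : (0 : ℝ) < Fintype.card V := by exact_mod_cast Fintype.card_pos
  positivity

end TreeIntegral

end TreeActivation

theorem proposition1 {V : Type*} [Fintype V] [DecidableEq V] [Nonempty V]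
    (n : ℕ) (δ : ℝ) (hδ : 0 < δ) (D : Matrix V V ℝ) (hD : D.PosDef)
    (x : Matrix (Fin n) V ℝ) :
    -- the prior given a tree is a probability density, and the mixture integrals converge
    (∀ T : SimpleGraph V, T.IsTree →
      Integrable (TreeActivation.hyperWishartKernel T δ D) (TreeActivation.entryMeasure T) ∧
      (∀ θ, 0 ≤ TreeActivation.hyperWishartDensity T δ D θ) ∧
      ∫ θ, TreeActivation.hyperWishartDensity T δ D θ ∂(TreeActivation.entryMeasure T) = 1 ∧
      Integrable (fun θ => TreeActivation.likelihood x (TreeActivation.precision T θ) *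
        TreeActivation.hyperWishartDensity T δ D θ) (TreeActivation.entryMeasure T)) ∧
    -- (i) the explicit formula
    TreeActivation.treeActivation δ D x =
      TreeActivation.weightFormula δ D x (TreeActivation.edgeWeight δ D x) ∧
    -- (ii) the weights are positive, and the formula is strictly increasing in each of them
    ((∀ i j : V, i ≠ j → 0 < TreeActivation.edgeWeight δ D x s(i, j)) ∧
      (∀ w : Sym2 V → ℝ, (∀ i j : V, i ≠ j → 0 < w s(i, j)) → ∀ i j : V, i ≠ j →
        StrictMonoOn
          (fun t : ℝ => TreeActivation.weightFormula δ D x (Function.update w s(i, j) t))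
          (Set.Ioi 0)) ∧
      -- so, among data with the same column norms, the activation increases with any weight
      (∀ y : Matrix (Fin n) V ℝ, (∀ i, ∑ r, y r i ^ 2 = ∑ r, x r i ^ 2) →
        (∀ i j : V, i ≠ j →
          TreeActivation.edgeWeight δ D x s(i, j) ≤ TreeActivation.edgeWeight δ D y s(i, j)) →
        (∃ i j : V, i ≠ j ∧
          TreeActivation.edgeWeight δ D x s(i, j) < TreeActivation.edgeWeight δ D y s(i, j)) →
        TreeActivation.treeActivation δ D x < TreeActivation.treeActivation δ D y)) ∧
    -- (iii) the weighted matrix-tree identity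
    (∀ (w : Sym2 V → ℝ) (u : V), TreeActivation.treeSum w =
      (TreeActivation.removeNodes (TreeActivation.laplacian w) {u}).det) := by
  classical
  refine ⟨fun T hT => ?_, TreeActivation.treeActivation_eq hδ hD x,
    ⟨fun i j hij => TreeActivation.edgeWeight_pos hδ hD x hij, ?_, ?_⟩,
    TreeActivation.treeSum_eq_det⟩
  · have hk := TreeActivation.integrable_hyperWishartKernel hT hδ hD
    have hpos := TreeActivation.treeConst_pos T hδ hD
    refine ⟨hk.1, fun θ => ?_, ?_, TreeActivation.integrable_likelihood_mul_density hT hδ hD x⟩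
    · rw [TreeActivation.hyperWishartDensity_eq hT hδ hD]
      exact div_nonneg (TreeActivation.hyperWishartKernel_nonneg T δ D θ) hpos.le
    · simp only [TreeActivation.hyperWishartDensity_eq hT hδ hD]
      rw [integral_div, hk.2, div_self hpos.ne']
  · intro w hw i j hij a ha b hb hab
    exact TreeActivation.strictMono_weightFormula hδ hD x
      (TreeActivation.strictMonoOn_treeSum_update hw hij ha hb hab)
  · intro y hxy hle hlt
    have hdiag : ∀ i, TreeActivation.rateStar D y i i = TreeActivation.rateStar D x i i :=
      fun i => by
        rw [TreeActivation.rateStar_apply_self, TreeActivation.rateStar_apply_self, hxy i]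
    -- The prefactor sees the data only through the diagonal of `D⋆`, that is through the column
    -- norms.
    have hy : TreeActivation.weightFormula δ D y (TreeActivation.edgeWeight δ D y) =
        TreeActivation.weightFormula δ D x (TreeActivation.edgeWeight δ D y) := by
      simp only [TreeActivation.weightFormula, hdiag]
    rw [TreeActivation.treeActivation_eq hδ hD x, TreeActivation.treeActivation_eq hδ hD y, hy]
    exact TreeActivation.strictMono_weightFormula hδ hD x
      (TreeActivation.treeSum_lt_treeSum
        (fun i j hij => TreeActivation.edgeWeight_pos hδ hD x hij) hle hlt)
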